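/- Let $X\in\mathbb R^{n\times p}$ ($p\ge 1$) have independent entries $X_{ij}\sim\mathcal N(\mu_{ij},\sigma^2)$, $\sigma>0$, with $\mu_i$ the $i$-th row of $\mu$. Let $d(M;x)\ge 0$ be any dissimilarity, measurable in the data matrix $x$, defined for unordered pairs $M=\{C,C'\}$ of clusters (subsets of $\{1,\dots,n\}$), and let $\tau>0$. *Randomized clustering.* Let $\mathcal C^{(1)}$ be the set of all singletons. At step $s\ge 1$ let $\mathcal M^{(s)}$ be the set of unordered pairs of distinct clusters in $\mathcal C^{(s)}$. Given $X=x$ and the earlier merges, the merge $M^{(s)}=\{C,C'\}$ is drawn from $\mathcal M^{(s)}$ with the softmax probabilities $$p^{(s)}(M;x)=\frac{\exp(-d(M;x)/\tau^{(s)})}{\sum_{M'\in\mathcal M^{(s)}}\exp(-d(M';x)/\tau^{(s)})},\qquad \tau^{(s)}=\frac{\tau}{|\mathcal M^{(s)}|}\sum_{M'\in\mathcal M^{(s)}}d(M';x)$$ (uniformly, if all these dissimilarities are $0$), and $C,C'$ are replaced by $C\cup C'$ to form $\mathcal C^{(s+1)}$. *Statistics.* Fix $t\ge 1$ and merges $M^{(1)}_o,\dots,M^{(t)}_o$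 that the algorithm can perform, in this order, with $M_o^{(t)}=\{C_1,C_2\}$ and $N=|C_1|+|C_2|\ge 3$. Write $\mathbf M^{(t)}=(M^{(1)},\dots,M^{(t)})$ and $\mathbf M^{(t)}_o=(M^{(1)}_o,\dots,M^{(t)}_o)$. With $\bar X_C$ the mean of the rows $X_i$, $i\in C$, put $$R=(N-2)\,\frac{\frac{|C_1||C_2|}{N}\|\bar X_{C_1}-\bar X_{C_2}\|_2^2}{\sum_{i\in C_1}\|X_i-\bar X_{C_1}\|_2^2+\sum_{i\in C_2}\|X_i-\bar X_{C_2}\|_2^2}.$$ With $1_C$ the indicator vector of $C$ and $I_C=\mathrm{diag}(1_C)$, let $\nu=1_{C_1}/|C_1|-1_{C_2}/|C_2|$, $B=\nu\nu^T/\|\nu\|_2^2$, $W=\sum_{k=1}^2\bigl(I_{C_k}-1_{C_k}1_{C_k}^T/|C_k|\bigr)$ and $\mathrm{dir}(A)=A/\|A\|_F$. The auxiliary statistics are $\mathcal A=(\eta,\gamma,\Delta,\Gamma)$, where $$\eta=\mathrm{dir}(BX),\quad \gamma=\mathrm{dir}(WX),\quad \Delta=\|BX\|_F^2+\|WX\|_F^2,\quad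 \Gamma=(I_n-B-W)X.$$ For a value $a=(\eta,\gamma,\Delta,\Gamma)$ of $\mathcal A$ and $r>0$ put $$X(r;a)=\sqrt{\Delta}\left(\eta\sqrt{\tfrac{r}{N-2+r}}+\gamma\sqrt{\tfrac{N-2}{N-2+r}}\right)+\Gamma .$$ *Theorem.* Suppose that the null hypothesis $H_0^{(t)}$ holds: $\mu_i=\mu_{i'}$ for all $i,i'\in C_1\cup C_2$. Then $\mathbb P(\mathbf M^{(t)}=\mathbf M^{(t)}_o)>0$, and for almost every value $\mathcal A_o$ of $\mathcal A$ (with respect to the law of $\mathcal A$ given $\mathbf M^{(t)}=\mathbf M^{(t)}_o$), the cumulative distribution function of the conditional distribution of $R$ given $\{\mathcal A=\mathcal A_o,\ \mathbf M^{(t)}=\mathbf M^{(t)}_o\}$ is, for all $r\ge 0$, $$\mathbb F^{(t)}(r;\mathcal A_o,\mathbf M^{(t)}_o)=\frac{\int_0^r \ell_{F_{p,(N-2)p}}(r')\prod_{s=1}^t p^{(s)}\bigl(M_o^{(s)};X(r';\mathcal A_o)\bigr)\,dr'}{\int_0^\infty \ell_{F_{p,(N-2)p}}(r')\prod_{s=1}^t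 p^{(s)}\bigl(M_o^{(s)};X(r';\mathcal A_o)\bigr)\,dr'}$$ and is $0$ for $r<0$. Here $\ell_{F_{p,(N-2)p}}$ is the density of the $F$ distribution with $p$ and $(N-2)p$ degrees of freedom, and $p^{(s)}(M_o^{(s)};\cdot)$ is computed with the candidate set $\mathcal M^{(s)}$ left by the merges $M_o^{(1)},\dots,M_o^{(s-1)}$. The integrals converge and the denominator is positive. -/

import Mathlib

open MeasureTheory ProbabilityTheory
open scoped NNReal Matrix

noncomputable section

namespace RandClust

/-- Data matrices carry the product (Borel) sigma-algebra of their entries. -/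
instance instMeasurableSpaceMatrix (m n : Type) : MeasurableSpace (Matrix m n ℝ) :=
  inferInstanceAs (MeasurableSpace (m → n → ℝ))

/-- A (candidate) merge of clusters of `{0, …, n-1}`: an unordered pair `{C₁, C₂}` of clusters. -/
abbrev Merge (n : ℕ) : Type := Sym2 (Finset (Fin n))

/-! ### The randomized agglomerative clustering algorithm -/

/-- The set `𝓜` of candidate merges for a collection `𝓒` of existing clusters: all unordered pairs
of distinct clusters in `𝓒`. -/
def candidates {n : ℕ} (𝓒 : Finset (Finset (Fin n))) : Finset (Merge n) :=
  𝓒.sym2.filter fun M => ¬ M.IsDiag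

/-- `clusters m s` is the collection of existing clusters before the merge number `s` (merges are
numbered `0, 1, 2, …`) when the merges performed are `m 0, m 1, …`.  It starts from the singletons,
and the merge `{C₁, C₂}` replaces `C₁` and `C₂` by `C₁ ∪ C₂`. -/
def clusters {n : ℕ} (m : ℕ → Merge n) : ℕ → Finset (Finset (Fin n))
  | 0 => Finset.univ.image fun i => {i}
  | s + 1 => insert (m s).sup ((clusters m s).filter fun C => C ∉ m s)

/-- The amount of randomization at a step: `τ` times the average dissimilarity over all candidate
merges. -/
def temperature {n p : ℕ} (d : Merge n → Matrix (Fin n) (Fin p) ℝ → ℝ) (τ : ℝ)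
    (𝓒 : Finset (Finset (Fin n))) (x : Matrix (Fin n) (Fin p) ℝ) : ℝ :=
  τ * ((∑ M ∈ candidates 𝓒, d M x) / (candidates 𝓒).card)

/-- The softmax probability that the merge `M` is selected, from the existing clusters `𝓒`, on
data `x`.  (If the dissimilarities are nonnegative and the temperature vanishes, then all
dissimilarities of candidate merges are `0`, every exponential is `1` and the selection is uniform,
as it would be for any positive temperature.) -/
def selProb {n p : ℕ} (d : Merge n → Matrix (Fin n) (Fin p) ℝ → ℝ) (τ : ℝ)
    (𝓒 : Finset (Finset (Fin n))) (M : Merge n) (x : Matrix (Fin n) (Fin p) ℝ) : ℝ :=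
  if M ∈ candidates 𝓒 then
    Real.exp (-(d M x / temperature d τ 𝓒 x)) /
      ∑ M' ∈ candidates 𝓒, Real.exp (-(d M' x / temperature d τ 𝓒 x))
  else 0

/-- The matrix normal law `MN(μ, Iₙ, σ² I_p)`: independent entries, the entry `(i, j)` having law
`N(μ i j, σ²)`. -/
def matrixNormal {n p : ℕ} (μ : Matrix (Fin n) (Fin p) ℝ) (σ : ℝ≥0) :
    Measure (Matrix (Fin n) (Fin p) ℝ) :=
  Measure.pi fun i => Measure.pi fun j => gaussianReal (μ i j) (σ ^ 2)

/-- The information available when merge number `s` is drawn: the data and the earlier merges. -/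
abbrev past {Ω : Type*} {n p : ℕ} (X : Ω → Matrix (Fin n) (Fin p) ℝ) (M : ℕ → Ω → Merge n) (s : ℕ) :
    MeasurableSpace Ω :=
  MeasurableSpace.comap X inferInstance ⊔ ⨆ j ∈ Finset.range s, MeasurableSpace.comap (M j) ⊤

/-- On the probability space `(Ω, P)`, `X` is a `MN(μ, Iₙ, σ² I_p)` data matrix and
`M 0, …, M t` are the merges that the randomized clustering algorithm with dissimilarity `d` and
randomization parameter `τ` performs on `X`: given the data and the earlier merges, `M s` is drawn
with the softmax probabilities of the candidate merges of the current clusters. -/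
structure IsRandomizedClustering {Ω : Type*} [MeasurableSpace Ω] {n p : ℕ} (P : Measure Ω)
    (μ : Matrix (Fin n) (Fin p) ℝ) (σ : ℝ≥0)
    (d : Merge n → Matrix (Fin n) (Fin p) ℝ → ℝ) (τ : ℝ) (t : ℕ)
    (X : Ω → Matrix (Fin n) (Fin p) ℝ) (M : ℕ → Ω → Merge n) : Prop where
  measurable_data : Measurable X
  law_data : P.map X = matrixNormal μ σ
  measurable_merge : ∀ s ≤ t, Measurable[_, ⊤] (M s)
  cond_prob_merge : ∀ s ≤ t, ∀ m : Merge n,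
    P⟦M s ⁻¹' {m} | past X M s⟧ =ᵐ[P]
      fun ω => selProb d τ (clusters (fun j => M j ω) s) m (X ω)

/-- The event that the merges numbered `0, …, t` are `m 0, …, m t`. -/
def mergesEq {Ω : Type*} {n : ℕ} (M : ℕ → Ω → Merge n) (m : ℕ → Merge n) (t : ℕ) : Set Ω :=
  {ω | ∀ s ≤ t, M s ω = m s}

/-! ### Test statistic and auxiliary statistics of a pair of clusters -/

section Statistics

variable {n p : ℕ} (C₁ C₂ : Finset (Fin n)) (x : Matrix (Fin n) (Fin p) ℝ)

/-- The mean `X̄_C` of the rows of `x` in the cluster `C`. -/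
def clusterMean (C : Finset (Fin n)) (x : Matrix (Fin n) (Fin p) ℝ) (j : Fin p) : ℝ :=
  (∑ i ∈ C, x i j) / C.card

/-- The number `N` of observations in the two clusters. -/
def pairSize : ℝ := (C₁.card : ℝ) + C₂.card

/-- Between-cluster sum of squares. -/
def bcss : ℝ :=
  (C₁.card * C₂.card / pairSize C₁ C₂) * ∑ j, (clusterMean C₁ x j - clusterMean C₂ x j) ^ 2

/-- Within-cluster sum of squares. -/
def wcss : ℝ :=
  (∑ i ∈ C₁, ∑ j, (x i j - clusterMean C₁ x j) ^ 2) +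
    ∑ i ∈ C₂, ∑ j, (x i j - clusterMean C₂ x j) ^ 2

/-- The test statistic `R = (N - 2) BCSS / WCSS`. -/
def testStat : ℝ := (pairSize C₁ C₂ - 2) * (bcss C₁ C₂ x / wcss C₁ C₂ x)

/-- The indicator vector `1_C`. -/
def ind (C : Finset (Fin n)) (i : Fin n) : ℝ := if i ∈ C then 1 else 0

/-- The contrast vector `ν = 1_{C₁}/|C₁| - 1_{C₂}/|C₂|`. -/
def nu (i : Fin n) : ℝ := ind C₁ i / C₁.card - ind C₂ i / C₂.card

/-- `B = ν νᵀ / ‖ν‖²`. -/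
def projB : Matrix (Fin n) (Fin n) ℝ :=
  (∑ i, nu C₁ C₂ i ^ 2)⁻¹ • Matrix.vecMulVec (nu C₁ C₂) (nu C₁ C₂)

/-- `I_C - 1_C 1_Cᵀ / |C|`. -/
def centering (C : Finset (Fin n)) : Matrix (Fin n) (Fin n) ℝ :=
  Matrix.diagonal (ind C) - (C.card : ℝ)⁻¹ • Matrix.vecMulVec (ind C) (ind C)

/-- `W = (I_{C₁} - 1_{C₁} 1_{C₁}ᵀ / |C₁|) + (I_{C₂} - 1_{C₂} 1_{C₂}ᵀ / |C₂|)`. -/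
def projW : Matrix (Fin n) (Fin n) ℝ := centering C₁ + centering C₂

/-- The squared Frobenius norm. -/
def frobSq (A : Matrix (Fin n) (Fin p) ℝ) : ℝ := ∑ i, ∑ j, A i j ^ 2

/-- The direction `A / ‖A‖_F` of a matrix. -/
def dir (A : Matrix (Fin n) (Fin p) ℝ) : Matrix (Fin n) (Fin p) ℝ := (√(frobSq A))⁻¹ • A

/-- The type of the values `(η, γ, Δ, Γ)` of the auxiliary statistics. -/
abbrev Aux (n p : ℕ) : Type :=
  Matrix (Fin n) (Fin p) ℝ × Matrix (Fin n) (Fin p) ℝ × ℝ × Matrix (Fin n) (Fin p) ℝ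

/-- The auxiliary statistics
`(dir (B X), dir (W X), ‖B X‖_F² + ‖W X‖_F², (I - B - W) X)`. -/
def auxStat : Aux n p :=
  (dir (projB C₁ C₂ * x), dir (projW C₁ C₂ * x),
    frobSq (projB C₁ C₂ * x) + frobSq (projW C₁ C₂ * x),
    (1 - projB C₁ C₂ - projW C₁ C₂) * x)

/-- The data matrix `X(r; (η, γ, Δ, Γ))` reconstructed from the value `r` of the test statistic and
the value of the auxiliary statistics. -/
def reconstruct (r : ℝ) : Aux n p → Matrix (Fin n) (Fin p) ℝ
  | (η, γ, Δ, Γ) =>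
    √Δ • (√(r / (pairSize C₁ C₂ - 2 + r)) • η +
      √((pairSize C₁ C₂ - 2) / (pairSize C₁ C₂ - 2 + r)) • γ) + Γ

end Statistics

/-- The density of the `F` distribution with `a` and `b` degrees of freedom. -/
def fDensity (a b r : ℝ) : ℝ :=
  if 0 < r then
    (beta (a / 2) (b / 2))⁻¹ * (a / b) ^ (a / 2) * r ^ (a / 2 - 1) *
      (1 + a / b * r) ^ (-((a + b) / 2))
  else 0

/-- The `F_{p, (N-2)p}` density at `r` times the product, over the steps `s = 0, …, t`, of the
selection probabilities of the merges `m s` on the reconstructed data `X(r; a)`; the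
candidate merges at step `s` are those left by the merges `m 0, …, m (s-1)`. -/
def selWeight {n p : ℕ} (d : Merge n → Matrix (Fin n) (Fin p) ℝ → ℝ) (τ : ℝ) (t : ℕ)
    (m : ℕ → Merge n) (C₁ C₂ : Finset (Fin n)) (a : Aux n p) (r : ℝ) : ℝ :=
  fDensity p ((pairSize C₁ C₂ - 2) * p) r *
    ∏ s ∈ Finset.range (t + 1), selProb d τ (clusters m s) (m s) (reconstruct C₁ C₂ r a)

end RandClust

end

/-!
Let `B`, `W` be the two orthogonal projections of the problem, acting on data matrices by left
multiplication, with ranges of dimensions `p` and `(N - 2) p`. Under the null hypothesis both kill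
the mean `μ`, so the Gaussian density is a product of a function of `‖B x‖² + ‖W x‖²` and a function
of the remaining component `x - B x - W x`. In polar coordinates on the two ranges, with radii `ρ`
and `κ`, Lebesgue measure becomes `ρ ^ (k - 1) κ ^ (l - 1) dρ dκ` times measures on the two unit
spheres, and two linear substitutions turn `(ρ, κ)` into the independent variables `ρ / κ` and
`√(ρ² + κ²)`. Hence the test statistic, which is `(N - 2) (ρ / κ)²`, is independent of the
auxiliary statistics, and its density is proportional to that of the `F` distribution
(`IsOrthogonalPair.exists_map_polarStat_eq_prod`, `exists_map_auxStat_testStat`). All multiplicative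
constants are left unspecified: they are determined by total mass, or cancel in the final ratio.

The event that the prescribed merges occur multiplies the law of the data by the product of the
softmax probabilities (`map_restrict_merges`, an induction on the number of merges), and the data
are almost surely a function of the test statistic and the auxiliary statistics
(`reconstruct_auxStat`). So, given this event, the joint law of the auxiliary statistics and the
test statistic has an explicit positive density with respect to a product measure, and normalizing
this density in the second variable gives the conditional distribution
(`condDistrib_ae_eq_of_map_eq_withDensity`).
-/

noncomputable section

namespace RandClust

open Set
open scoped ENNReal

/-! ### Lebesgue integrals over products, in polar coordinates, and under scalings -/

theorem lintegral_fin_prod_eq_prod {α : Type*} [MeasurableSpace α] {n : ℕ}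
    (ν : Fin n → Measure α) [∀ i, SigmaFinite (ν i)] (f : Fin n → α → ℝ≥0∞)
    (hf : ∀ i, Measurable (f i)) :
    ∫⁻ x : Fin n → α, ∏ i, f i (x i) ∂(Measure.pi ν) = ∏ i, ∫⁻ x, f i x ∂(ν i) := by
  induction n with
  | zero => simp
  | succ n ih =>
    have h := (measurePreserving_piFinSuccAbove ν 0).symm
    rw [← h.lintegral_comp_emb (MeasurableEquiv.measurableEmbedding _)]
    have h2 : ∀ x : α × (Fin n → α),
        ∏ i, f i ((MeasurableEquiv.piFinSuccAbove (fun _ => α) 0).symm x i) =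
          f 0 x.1 * ∏ i : Fin n, f i.succ (x.2 i) := by
      intro x
      rw [Fin.prod_univ_succ]
      rfl
    simp_rw [h2]
    have hm : Measurable fun x : Fin n → α => ∏ i : Fin n, f i.succ (x i) :=
      Finset.measurable_prod _ fun i _ => (hf i.succ).comp (measurable_pi_apply i)
    rw [lintegral_prod_mul (g := fun x : Fin n → α => ∏ i : Fin n, f i.succ (x i))
      (hf 0).aemeasurable hm.aemeasurable, Fin.prod_univ_succ]
    congr 1
    exact ih (fun i => ν i.succ) (fun i => f i.succ) (fun i => hf i.succ)

theorem pi_withDensity_fin {α : Type*} [MeasurableSpace α] {n : ℕ}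
    (ν : Fin n → Measure α) [∀ i, SigmaFinite (ν i)] (f : Fin n → α → ℝ≥0∞)
    (hf : ∀ i, Measurable (f i)) [∀ i, SigmaFinite ((ν i).withDensity (f i))] :
    Measure.pi (fun i => (ν i).withDensity (f i)) =
      (Measure.pi ν).withDensity (fun x => ∏ i, f i (x i)) := by
  refine Measure.pi_eq fun s hs => ?_
  rw [withDensity_apply _ (MeasurableSet.univ_pi hs), ← lintegral_indicator (MeasurableSet.univ_pi hs)]
  have h : ∀ x : Fin n → α, (univ.pi s).indicator (fun x => ∏ i, f i (x i)) x =
      ∏ i, (s i).indicator (f i) (x i) := by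
    intro x
    by_cases hx : x ∈ univ.pi s
    · rw [indicator_of_mem hx]
      exact Finset.prod_congr rfl fun i _ => (indicator_of_mem (hx i (mem_univ i)) _).symm
    · rw [indicator_of_notMem hx]
      simp only [mem_pi, mem_univ, true_imp_iff, not_forall] at hx
      obtain ⟨i, hi⟩ := hx
      exact (Finset.prod_eq_zero (Finset.mem_univ i) (indicator_of_notMem hi _)).symm
  simp_rw [h]
  rw [lintegral_fin_prod_eq_prod ν _ fun i => (hf i).indicator (hs i)]
  refine Finset.prod_congr rfl fun i _ => ?_
  rw [lintegral_indicator (hs i), withDensity_apply _ (hs i)]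

theorem lintegral_polar {E : Type*} [NormedAddCommGroup E] [NormedSpace ℝ E]
    [FiniteDimensional ℝ E] [MeasurableSpace E] [BorelSpace E] [Nontrivial E]
    (ν : Measure E) [ν.IsAddHaarMeasure] {f : E → ℝ≥0∞} (hf : Measurable f) :
    ∫⁻ x, f x ∂ν = ∫⁻ θ, (∫⁻ ρ in Ioi (0 : ℝ),
      ENNReal.ofReal (ρ ^ (Module.finrank ℝ E - 1)) * f (ρ • (θ : E))) ∂ν.toSphere := by
  have h0 : ∫⁻ x, f x ∂ν = ∫⁻ x : ({0}ᶜ : Set E), f x ∂(ν.comap (↑)) := by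
    rw [lintegral_subtype_comap (measurableSet_singleton _).compl, restrict_compl_singleton]
  have h1 := ν.measurePreserving_homeomorphUnitSphereProd.symm
    (homeomorphUnitSphereProd E).toMeasurableEquiv
  rw [h0, ← h1.lintegral_comp_emb (MeasurableEquiv.measurableEmbedding _)]
  rw [lintegral_prod]
  · refine lintegral_congr fun θ => ?_
    rw [Measure.volumeIoiPow, lintegral_withDensity_eq_lintegral_mul]
    · rw [← lintegral_subtype_comap measurableSet_Ioi]
      rfl
    · fun_prop
    · have : Measurable fun r : Ioi (0 : ℝ) => f ((r : ℝ) • (θ : E)) := by fun_prop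
      exact this
  · have : Measurable fun q : Metric.sphere (0 : E) 1 × Ioi (0 : ℝ) =>
        f ((q.2 : ℝ) • (q.1 : E)) := by fun_prop
    exact this.aemeasurable

theorem lintegral_Ioi_scale {c : ℝ} (hc : 0 < c) (f : ℝ → ℝ≥0∞) :
    ∫⁻ x in Ioi (0 : ℝ), f x = ∫⁻ x in Ioi (0 : ℝ), ENNReal.ofReal c * f (c * x) := by
  have h := lintegral_image_eq_lintegral_abs_deriv_mul (s := Ioi (0 : ℝ)) (f := fun x => c * x)
    (f' := fun _ => c) measurableSet_Ioi
    (fun x _ => by simpa using ((hasDerivAt_id x).const_mul c).hasDerivWithinAt)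
    (fun x _ y _ hxy => mul_left_cancel₀ hc.ne' hxy) f
  rw [abs_of_pos hc] at h
  rw [← h, show (fun x => c * x) '' Ioi (0 : ℝ) = Ioi 0 from ?_]
  rw [Set.image_mul_left_Ioi hc, mul_zero]

/-- The unnormalized density of the ratio of the norms of two independent centred isotropic Gaussian
vectors of dimensions `k` and `l`. -/
def ratioDensity (k l : ℕ) (s : ℝ) : ℝ := s ^ (k - 1) * (√(1 + s ^ 2))⁻¹ ^ (k + l)

@[fun_prop]
theorem measurable_ratioDensity (k l : ℕ) : Measurable (ratioDensity k l) := by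
  unfold ratioDensity; fun_prop

/-- The substitution of `s = ρ / κ` and `δ = √(ρ² + κ²)` for `(ρ, κ)`, under which the radial parts
of Gaussian densities in dimensions `k` and `l` separate. It is the composition of the two linear
substitutions `ρ = κ s`, for fixed `κ`, and `κ = δ / √(1 + s²)`, for fixed `s`. -/
theorem lintegral_ratio_sum_sq {k l : ℕ} (hk : 0 < k) (hl : 0 < l) (a : ℝ)
    {H : ℝ → ℝ → ℝ≥0∞} (hH : Measurable fun q : ℝ × ℝ => H q.1 q.2) :
    ∫⁻ κ in Ioi (0 : ℝ), ENNReal.ofReal (κ ^ (l - 1)) *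
        ∫⁻ ρ in Ioi (0 : ℝ), ENNReal.ofReal (ρ ^ (k - 1)) *
          (ENNReal.ofReal (Real.exp (-(a * (ρ ^ 2 + κ ^ 2)))) * H (ρ / κ) (ρ ^ 2 + κ ^ 2)) =
      ∫⁻ δ in Ioi (0 : ℝ), ENNReal.ofReal (δ ^ (k + l - 1) * Real.exp (-(a * δ ^ 2))) *
        ∫⁻ s in Ioi (0 : ℝ), ENNReal.ofReal (ratioDensity k l s) * H s (δ ^ 2) := by
  have hHc : ∀ {α : Type} [MeasurableSpace α] {f g : α → ℝ}, Measurable f → Measurable g →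
      Measurable fun x => H (f x) (g x) := fun hf hg => hH.comp (hf.prodMk hg)
  have step1 : ∀ κ ∈ Ioi (0 : ℝ), ENNReal.ofReal (κ ^ (l - 1)) *
        (∫⁻ ρ in Ioi (0 : ℝ), ENNReal.ofReal (ρ ^ (k - 1)) *
          (ENNReal.ofReal (Real.exp (-(a * (ρ ^ 2 + κ ^ 2)))) * H (ρ / κ) (ρ ^ 2 + κ ^ 2))) =
      ∫⁻ s in Ioi (0 : ℝ), ENNReal.ofReal (s ^ (k - 1)) *
        (ENNReal.ofReal (κ ^ (k + l - 1) * Real.exp (-(a * (κ ^ 2 * (1 + s ^ 2))))) *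
          H s (κ ^ 2 * (1 + s ^ 2))) := by
    intro κ hκ
    have hκ' : (0 : ℝ) < κ := hκ
    rw [lintegral_Ioi_scale hκ', ← lintegral_const_mul' _ _ ENNReal.ofReal_ne_top]
    refine setLIntegral_congr_fun measurableSet_Ioi fun s hs => ?_
    have hs' : (0 : ℝ) < s := hs
    have e1 : κ * s / κ = s := by field_simp
    have e2 : (κ * s) ^ 2 + κ ^ 2 = κ ^ 2 * (1 + s ^ 2) := by ring
    simp only [e1, e2]
    simp only [← mul_assoc]
    congr 1
    rw [← ENNReal.ofReal_mul (by positivity), ← ENNReal.ofReal_mul (by positivity),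
      ← ENNReal.ofReal_mul (by positivity), ← ENNReal.ofReal_mul (by positivity)]
    congr 1
    obtain ⟨k, rfl⟩ := Nat.exists_eq_succ_of_ne_zero hk.ne'
    obtain ⟨l, rfl⟩ := Nat.exists_eq_succ_of_ne_zero hl.ne'
    have : k.succ + l.succ - 1 = k + l + 1 := by omega
    rw [this]
    simp only [Nat.succ_eq_add_one, Nat.add_sub_cancel]
    ring
  rw [setLIntegral_congr_fun measurableSet_Ioi step1, lintegral_lintegral_swap]
  swap
  · have : Measurable fun q : ℝ × ℝ => H q.2 (q.1 ^ 2 * (1 + q.2 ^ 2)) :=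
      hHc (by fun_prop) (by fun_prop)
    unfold Function.uncurry
    fun_prop
  have step2 : ∀ s ∈ Ioi (0 : ℝ), (∫⁻ κ in Ioi (0 : ℝ), ENNReal.ofReal (s ^ (k - 1)) *
        (ENNReal.ofReal (κ ^ (k + l - 1) * Real.exp (-(a * (κ ^ 2 * (1 + s ^ 2))))) *
          H s (κ ^ 2 * (1 + s ^ 2)))) =
      ∫⁻ δ in Ioi (0 : ℝ), ENNReal.ofReal (δ ^ (k + l - 1) * Real.exp (-(a * δ ^ 2))) *
        (ENNReal.ofReal (ratioDensity k l s) * H s (δ ^ 2)) := by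
    intro s hs
    have hs' : (0 : ℝ) < s := hs
    have hc : 0 < (√(1 + s ^ 2))⁻¹ := by positivity
    rw [lintegral_Ioi_scale hc]
    refine setLIntegral_congr_fun measurableSet_Ioi fun δ hδ => ?_
    have hδ' : (0 : ℝ) < δ := hδ
    have e1 : ((√(1 + s ^ 2))⁻¹ * δ) ^ 2 * (1 + s ^ 2) = δ ^ 2 := by
      rw [mul_pow, inv_pow, Real.sq_sqrt (by positivity)]
      field_simp
    simp only [e1]
    simp only [← mul_assoc]
    congr 1
    rw [← ENNReal.ofReal_mul (by positivity), ← ENNReal.ofReal_mul (by positivity),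
      ← ENNReal.ofReal_mul (by positivity)]
    congr 1
    obtain ⟨m, hm⟩ := Nat.exists_eq_succ_of_ne_zero (show k + l ≠ 0 by omega)
    rw [ratioDensity, hm]
    simp only [Nat.succ_eq_add_one, Nat.add_sub_cancel]
    ring
  rw [setLIntegral_congr_fun measurableSet_Ioi step2, lintegral_lintegral_swap]
  swap
  · have : Measurable fun q : ℝ × ℝ => H q.1 (q.2 ^ 2) := hHc (by fun_prop) (by fun_prop)
    unfold Function.uncurry
    fun_prop
  refine lintegral_congr fun δ => ?_
  rw [lintegral_const_mul' _ _ ENNReal.ofReal_ne_top]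

/-! ### Polar coordinates along two orthogonal projections -/

section Decomposition

variable {E : Type*} [NormedAddCommGroup E] [NormedSpace ℝ E]

/-- `E` carries two projections with `B W = W B = 0`, and the squared norm is additive along the
decomposition `x = B x + W x + (x - B x - W x)`. -/
structure IsOrthogonalPair (B W : E →ₗ[ℝ] E) : Prop where
  BB : ∀ x, B (B x) = B x
  WW : ∀ x, W (W x) = W x
  BW : ∀ x, B (W x) = 0
  WB : ∀ x, W (B x) = 0
  pythagoras : ∀ x, ‖x‖ ^ 2 = ‖B x‖ ^ 2 + ‖W x‖ ^ 2 + ‖x - B x - W x‖ ^ 2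

variable {B W : E →ₗ[ℝ] E}

/-- The decomposition of `E` into the ranges of `1 - B - W`, `W` and `B`. -/
def IsOrthogonalPair.sumEquiv [FiniteDimensional ℝ E] (h : IsOrthogonalPair B W) :
    (LinearMap.range (LinearMap.id - B - W) × LinearMap.range W × LinearMap.range B) ≃L[ℝ] E :=
  LinearEquiv.toContinuousLinearEquiv
  { toFun := fun q => (q.1 : E) + q.2.1 + q.2.2
    map_add' := fun q q' => by
      simp only [Prod.fst_add, Prod.snd_add, Submodule.coe_add]; abel
    map_smul' := fun c q => by simp [smul_add]
    invFun := fun x => ((LinearMap.id - B - W).rangeRestrict x, W.rangeRestrict x,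
      B.rangeRestrict x)
    left_inv := by
      rintro ⟨⟨_, z, rfl⟩, ⟨_, v, rfl⟩, ⟨_, u, rfl⟩⟩
      ext <;> simp [h.BB, h.WW, h.BW, h.WB]
    right_inv := fun x => by simp }

theorem IsOrthogonalPair.sumEquiv_apply [FiniteDimensional ℝ E] (h : IsOrthogonalPair B W)
    (q : LinearMap.range (LinearMap.id - B - W) × LinearMap.range W × LinearMap.range B) :
    h.sumEquiv q = (q.1 : E) + q.2.1 + q.2.2 := rfl

variable [FiniteDimensional ℝ E] [MeasurableSpace E] [BorelSpace E]

/-- Integration over `E` in polar coordinates on the ranges of `B` and `W`. The constant `C` compares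
the given Haar measure with the product of the Haar measures on the three ranges. -/
theorem IsOrthogonalPair.exists_lintegral_eq_polar (h : IsOrthogonalPair B W)
    (hB : 0 < Module.finrank ℝ (LinearMap.range B)) (hW : 0 < Module.finrank ℝ (LinearMap.range W))
    (vol : Measure E) [vol.IsAddHaarMeasure] :
    ∃ C : ℝ≥0, ∀ G : E → ℝ≥0∞, Measurable G → ∫⁻ x, G x ∂vol = C *
      ∫⁻ z, ∫⁻ θ, ∫⁻ φ, (∫⁻ κ in Ioi (0 : ℝ),
        ENNReal.ofReal (κ ^ (Module.finrank ℝ (LinearMap.range W) - 1)) *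
        ∫⁻ ρ in Ioi (0 : ℝ), ENNReal.ofReal (ρ ^ (Module.finrank ℝ (LinearMap.range B) - 1)) *
          G ((z : E) + κ • ((φ : LinearMap.range W) : E) + ρ • ((θ : LinearMap.range B) : E)))
        ∂(Measure.addHaar (G := LinearMap.range W)).toSphere
        ∂(Measure.addHaar (G := LinearMap.range B)).toSphere
        ∂(Measure.addHaar (G := LinearMap.range (LinearMap.id - B - W))) := by
  have := Module.finrank_pos_iff.1 hB
  have := Module.finrank_pos_iff.1 hW
  set νU := Measure.addHaar (G := LinearMap.range B)
  set νV := Measure.addHaar (G := LinearMap.range W)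
  set νZ := Measure.addHaar (G := LinearMap.range (LinearMap.id - B - W))
  have hprod : (νV.prod νU).IsAddHaarMeasure := Measure.prod.instIsAddHaarMeasure _ _
  have hprod' : (νZ.prod (νV.prod νU)).IsAddHaarMeasure := Measure.prod.instIsAddHaarMeasure _ _
  have hmap : ((νZ.prod (νV.prod νU)).map h.sumEquiv).IsAddHaarMeasure :=
    h.sumEquiv.isAddHaarMeasure_map _
  refine ⟨Measure.addHaarScalarFactor vol ((νZ.prod (νV.prod νU)).map h.sumEquiv), fun G hG => ?_⟩
  conv_lhs => rw [Measure.isAddLeftInvariant_eq_smul vol ((νZ.prod (νV.prod νU)).map h.sumEquiv)]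
  rw [lintegral_smul_measure, lintegral_map hG h.sumEquiv.continuous.measurable]
  have hGs : Measurable fun q => G (h.sumEquiv q) := hG.comp h.sumEquiv.continuous.measurable
  rw [lintegral_prod _ hGs.aemeasurable]
  congr 1
  refine lintegral_congr fun z => ?_
  have hGz : Measurable fun q : LinearMap.range W × LinearMap.range B =>
      G ((z : E) + q.1 + q.2) := by fun_prop
  simp only [h.sumEquiv_apply]
  rw [lintegral_prod _ hGz.aemeasurable]
  calc ∫⁻ v, ∫⁻ u, G ((z : E) + v + u) ∂νU ∂νV
      = ∫⁻ v, ∫⁻ θ, (∫⁻ ρ in Ioi (0 : ℝ),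
          ENNReal.ofReal (ρ ^ (Module.finrank ℝ (LinearMap.range B) - 1)) *
          G ((z : E) + v + ρ • ((θ : LinearMap.range B) : E))) ∂νU.toSphere ∂νV := by
        refine lintegral_congr fun v => ?_
        rw [lintegral_polar νU (f := fun u : LinearMap.range B => G ((z : E) + v + u))
          (by fun_prop)]
        simp only [Submodule.coe_smul]
    _ = ∫⁻ θ, ∫⁻ v, (∫⁻ ρ in Ioi (0 : ℝ),
          ENNReal.ofReal (ρ ^ (Module.finrank ℝ (LinearMap.range B) - 1)) *
          G ((z : E) + v + ρ • ((θ : LinearMap.range B) : E))) ∂νV ∂νU.toSphere := by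
        rw [lintegral_lintegral_swap]
        refine Measurable.aemeasurable ?_
        unfold Function.uncurry
        refine Measurable.lintegral_prod_right' (f := fun q : (LinearMap.range W ×
          Metric.sphere (0 : LinearMap.range B) 1) × ℝ =>
          ENNReal.ofReal (q.2 ^ (Module.finrank ℝ (LinearMap.range B) - 1)) *
          G ((z : E) + q.1.1 + q.2 • ((q.1.2 : LinearMap.range B) : E))) ?_
        fun_prop
    _ = _ := by
        refine lintegral_congr fun θ => ?_
        rw [lintegral_polar νV (f := fun v : LinearMap.range W => ∫⁻ ρ in Ioi (0 : ℝ),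
          ENNReal.ofReal (ρ ^ (Module.finrank ℝ (LinearMap.range B) - 1)) *
          G ((z : E) + v + ρ • ((θ : LinearMap.range B) : E)))]
        · simp only [Submodule.coe_smul]
        refine Measurable.lintegral_prod_right' (f := fun q : LinearMap.range W × ℝ =>
          ENNReal.ofReal (q.2 ^ (Module.finrank ℝ (LinearMap.range B) - 1)) *
          G ((z : E) + q.1 + q.2 • ((θ : LinearMap.range B) : E))) ?_
        fun_prop

end Decomposition

/-! ### Independence of the ratio of the norms of two Gaussian projections -/

section ProductLaw

variable {E : Type*} [NormedAddCommGroup E] [NormedSpace ℝ E] {B W : E →ₗ[ℝ] E}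

variable (B W) in
/-- The ratio of the norms of the two projections, together with their directions, the sum of
their squared norms, and the remaining component. -/
def polarStat (x : E) : ℝ × E × E × ℝ × E :=
  (‖B x‖ / ‖W x‖, ‖B x‖⁻¹ • B x, ‖W x‖⁻¹ • W x, ‖B x‖ ^ 2 + ‖W x‖ ^ 2, x - B x - W x)

theorem IsOrthogonalPair.polarStat_add (h : IsOrthogonalPair B W)
    (z : LinearMap.range (LinearMap.id - B - W)) {φ : LinearMap.range W} {θ : LinearMap.range B}
    (hφ : ‖φ‖ = 1) (hθ : ‖θ‖ = 1) {κ ρ : ℝ} (hκ : 0 < κ) (hρ : 0 < ρ) :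
    polarStat B W ((z : E) + κ • (φ : E) + ρ • (θ : E)) =
      (ρ / κ, (θ : E), (φ : E), ρ ^ 2 + κ ^ 2, (z : E)) := by
  obtain ⟨_, z, rfl⟩ := z
  obtain ⟨_, v, rfl⟩ := φ
  obtain ⟨_, u, rfl⟩ := θ
  have hφ' : ‖W v‖ = 1 := hφ
  have hθ' : ‖B u‖ = 1 := hθ
  have e1 : B ((LinearMap.id - B - W : E →ₗ[ℝ] E) z + κ • W v + ρ • B u) = ρ • B u := by
    simp [h.BB, h.BW]
  have e2 : W ((LinearMap.id - B - W : E →ₗ[ℝ] E) z + κ • W v + ρ • B u) = κ • W v := by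
    simp [h.WW, h.WB]
  simp only [polarStat, e1, e2, norm_smul, hφ', hθ', Real.norm_of_nonneg hκ.le,
    Real.norm_of_nonneg hρ.le, mul_one, smul_smul, inv_mul_cancel₀ hκ.ne', inv_mul_cancel₀ hρ.ne',
    one_smul]
  congr 4
  abel

theorem IsOrthogonalPair.norm_sub_sq (h : IsOrthogonalPair B W) {x₀ : E} (hB : B x₀ = 0)
    (hW : W x₀ = 0)
    (z : LinearMap.range (LinearMap.id - B - W)) {φ : LinearMap.range W} {θ : LinearMap.range B}
    (hφ : ‖φ‖ = 1) (hθ : ‖θ‖ = 1) (κ ρ : ℝ) :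
    ‖(z : E) + κ • (φ : E) + ρ • (θ : E) - x₀‖ ^ 2 = ρ ^ 2 + κ ^ 2 + ‖(z : E) - x₀‖ ^ 2 := by
  obtain ⟨_, z, rfl⟩ := z
  obtain ⟨_, v, rfl⟩ := φ
  obtain ⟨_, u, rfl⟩ := θ
  have hφ' : ‖W v‖ = 1 := hφ
  have hθ' : ‖B u‖ = 1 := hθ
  have e1 : B ((LinearMap.id - B - W : E →ₗ[ℝ] E) z + κ • W v + ρ • B u - x₀) = ρ • B u := by
    simp [h.BB, h.BW, hB]
  have e2 : W ((LinearMap.id - B - W : E →ₗ[ℝ] E) z + κ • W v + ρ • B u - x₀) = κ • W v := by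
    simp [h.WW, h.WB, hW]
  simp only
  rw [h.pythagoras, e1, e2]
  simp only [norm_smul, hφ', hθ', mul_one, Real.norm_eq_abs, sq_abs]
  congr 3
  abel

variable [FiniteDimensional ℝ E] [MeasurableSpace E] [BorelSpace E]

theorem measurable_polarStat : Measurable (polarStat B W) := by
  have hB : Measurable B := B.continuous_of_finiteDimensional.measurable
  have hW : Measurable W := W.continuous_of_finiteDimensional.measurable
  unfold polarStat
  fun_prop

/-- For an isotropic Gaussian law centred at a point that both projections kill, the ratio of the
norms of the projections is independent of the other components of `polarStat`, and has a density
proportional to `ratioDensity`. -/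
theorem IsOrthogonalPair.exists_map_polarStat_eq_prod (h : IsOrthogonalPair B W)
    (hB : 0 < Module.finrank ℝ (LinearMap.range B)) (hW : 0 < Module.finrank ℝ (LinearMap.range W))
    (vol : Measure E) [hvol : vol.IsAddHaarMeasure] (C : ℝ≥0) (a : ℝ) {x₀ : E} (hBx : B x₀ = 0)
    (hWx : W x₀ = 0) :
    ∃ Q : Measure (E × E × ℝ × E), SFinite Q ∧
      (vol.withDensity fun x => C * ENNReal.ofReal (Real.exp (-(a * ‖x - x₀‖ ^ 2)))).map
          (polarStat B W) =
        ((volume.restrict (Ioi 0)).withDensity fun s => ENNReal.ofReal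
          (ratioDensity (Module.finrank ℝ (LinearMap.range B))
            (Module.finrank ℝ (LinearMap.range W)) s)).prod Q := by
  obtain ⟨C₀, hC₀⟩ := h.exists_lintegral_eq_polar hB hW vol
  have := Module.finrank_pos_iff.1 hB
  have := Module.finrank_pos_iff.1 hW
  set k := Module.finrank ℝ (LinearMap.range B)
  set l := Module.finrank ℝ (LinearMap.range W)
  set νU := Measure.addHaar (G := LinearMap.range B)
  set νV := Measure.addHaar (G := LinearMap.range W)
  set νZ := Measure.addHaar (G := LinearMap.range (LinearMap.id - B - W))
  -- the measures of the remaining component `z` and of `δ = √(‖B x‖² + ‖W x‖²)`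
  let gz : LinearMap.range (LinearMap.id - B - W) → ℝ≥0∞ := fun z =>
    C₀ * (C * ENNReal.ofReal (Real.exp (-(a * ‖(z : E) - x₀‖ ^ 2))))
  have hgz : Measurable gz := by fun_prop
  let gδ : ℝ → ℝ≥0∞ := fun δ => ENNReal.ofReal (δ ^ (k + l - 1) * Real.exp (-(a * δ ^ 2)))
  have hgδ : Measurable gδ := by fun_prop
  let T : LinearMap.range (LinearMap.id - B - W) × Metric.sphere (0 : LinearMap.range B) 1 ×
      Metric.sphere (0 : LinearMap.range W) 1 × ℝ → E × E × ℝ × E := fun q =>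
    (((q.2.1 : LinearMap.range B) : E), ((q.2.2.1 : LinearMap.range W) : E), q.2.2.2 ^ 2, (q.1 : E))
  have hT : Measurable T := by fun_prop
  have : SFinite (νV.toSphere.prod ((volume.restrict (Ioi 0)).withDensity gδ)) :=
    Measure.prod.instSFinite
  have : SFinite (νU.toSphere.prod (νV.toSphere.prod ((volume.restrict (Ioi 0)).withDensity gδ))) :=
    Measure.prod.instSFinite
  have : SFinite ((νZ.withDensity gz).prod (νU.toSphere.prod (νV.toSphere.prod
    ((volume.restrict (Ioi 0)).withDensity gδ)))) := Measure.prod.instSFinite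
  refine ⟨((νZ.withDensity gz).prod (νU.toSphere.prod (νV.toSphere.prod
    ((volume.restrict (Ioi 0)).withDensity gδ)))).map T, inferInstance, ?_⟩
  have hw : Measurable fun s => ENNReal.ofReal (ratioDensity k l s) := by fun_prop
  refine Measure.ext_of_lintegral _ fun f hf => ?_
  have hΦ : Measurable (polarStat B W) := measurable_polarStat
  rw [lintegral_map hf hΦ, lintegral_withDensity_eq_lintegral_mul _ (by fun_prop) (by fun_prop)]
  simp only [Pi.mul_apply]
  rw [hC₀ _ (by fun_prop)]
  -- the right-hand side, as an iterated integral
  have hJ : Measurable fun q : E × E × ℝ × E =>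
      ∫⁻ s in Ioi 0, ENNReal.ofReal (ratioDensity k l s) * f (s, q) :=
    Measurable.lintegral_prod_right' (f := fun q : (E × E × ℝ × E) × ℝ =>
      ENNReal.ofReal (ratioDensity k l q.2) * f (q.2, q.1)) (by fun_prop)
  rw [lintegral_prod_symm _ hf.aemeasurable]
  have hinner : ∀ q : E × E × ℝ × E, ∫⁻ s, f (s, q) ∂((volume.restrict (Ioi 0)).withDensity
      fun s => ENNReal.ofReal (ratioDensity k l s)) =
      ∫⁻ s in Ioi 0, ENNReal.ofReal (ratioDensity k l s) * f (s, q) := fun q =>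
    lintegral_withDensity_eq_lintegral_mul _ hw (by fun_prop)
  simp_rw [hinner]
  set J : E × E × ℝ × E → ℝ≥0∞ := fun q =>
      ∫⁻ s in Ioi 0, ENNReal.ofReal (ratioDensity k l s) * f (s, q) with hJdef
  rw [lintegral_map hJ hT, lintegral_prod _ (by fun_prop)]
  have hJT : Measurable fun q => J (T q) := hJ.comp hT
  rw [lintegral_withDensity_eq_lintegral_mul _ hgz
    (Measurable.lintegral_prod_right' (f := fun q => J (T q)) hJT)]
  rw [← lintegral_const_mul' _ _ ENNReal.coe_ne_top]
  refine lintegral_congr fun z => ?_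
  simp only [Pi.mul_apply]
  rw [lintegral_prod _ (by fun_prop)]
  simp only [gz]
  rw [mul_assoc]
  congr 1
  have hne : (C : ℝ≥0∞) * ENNReal.ofReal (Real.exp (-(a * ‖(z : E) - x₀‖ ^ 2))) ≠ ∞ := by finiteness
  rw [← lintegral_const_mul' _ _ hne]
  refine lintegral_congr fun θ => ?_
  rw [lintegral_prod _ (by fun_prop), ← lintegral_const_mul' _ _ hne]
  refine lintegral_congr fun φ => ?_
  rw [lintegral_withDensity_eq_lintegral_mul _ hgδ (by fun_prop)]
  simp only [Pi.mul_apply, gδ, hJdef, T]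
  rw [← lintegral_ratio_sum_sq (k := k) (l := l) hB hW a
    (H := fun s δ => f (s, (θ : LinearMap.range B), (φ : LinearMap.range W), δ, z)) (by fun_prop),
    ← lintegral_const_mul' _ _ hne]
  refine setLIntegral_congr_fun measurableSet_Ioi fun κ hκ => ?_
  rw [mul_left_comm, ← lintegral_const_mul' _ _ hne]
  congr 1
  refine setLIntegral_congr_fun measurableSet_Ioi fun ρ hρ => ?_
  have hφ : ‖(φ : LinearMap.range W)‖ = 1 := by simp
  have hθ : ‖(θ : LinearMap.range B)‖ = 1 := by simp
  rw [h.polarStat_add z hφ hθ hκ hρ, h.norm_sub_sq hBx hWx z hφ hθ, mul_add, neg_add,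
    Real.exp_add, ENNReal.ofReal_mul (Real.exp_nonneg _)]
  ring

end ProductLaw

/-! ### The projection matrices, and the clusters -/

section Projections

variable {n p : ℕ} {C C₁ C₂ : Finset (Fin n)}

theorem ind_dotProduct_ind (C : Finset (Fin n)) : ind C ⬝ᵥ ind C = C.card := by
  simp [dotProduct, ind]

theorem ind_mul_ind_of_disjoint (h : Disjoint C₁ C₂) (i : Fin n) : ind C₁ i * ind C₂ i = 0 := by
  by_cases h1 : i ∈ C₁
  · simp [ind, Finset.disjoint_left.1 h h1]
  · simp [ind, h1]

theorem ind_dotProduct_ind_of_disjoint (h : Disjoint C₁ C₂) : ind C₁ ⬝ᵥ ind C₂ = 0 := by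
  simp [dotProduct, ind_mul_ind_of_disjoint h]

theorem nu_eq (C₁ C₂ : Finset (Fin n)) :
    nu C₁ C₂ = (C₁.card : ℝ)⁻¹ • ind C₁ - (C₂.card : ℝ)⁻¹ • ind C₂ := by
  ext i; simp [nu, div_eq_inv_mul]

theorem nu_dotProduct_self (C₁ C₂ : Finset (Fin n)) :
    nu C₁ C₂ ⬝ᵥ nu C₁ C₂ = ∑ i, nu C₁ C₂ i ^ 2 := by simp [dotProduct, sq]

theorem sum_nu_sq (h₁ : C₁.Nonempty) (h₂ : C₂.Nonempty) (h : Disjoint C₁ C₂) :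
    ∑ i, nu C₁ C₂ i ^ 2 = (C₁.card : ℝ)⁻¹ + (C₂.card : ℝ)⁻¹ := by
  have c₁ : (C₁.card : ℝ) ≠ 0 := by simpa using h₁.ne_empty
  have c₂ : (C₂.card : ℝ) ≠ 0 := by simpa using h₂.ne_empty
  rw [← nu_dotProduct_self, nu_eq]
  simp only [sub_dotProduct, dotProduct_sub, smul_dotProduct, dotProduct_smul, ind_dotProduct_ind,
    ind_dotProduct_ind_of_disjoint h, ind_dotProduct_ind_of_disjoint h.symm, smul_eq_mul]
  field_simp
  ring

theorem diagonal_ind_mulVec_ind (C : Finset (Fin n)) :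
    Matrix.diagonal (ind C) *ᵥ ind C = ind C := by
  ext i; simp [Matrix.mulVec_diagonal, ind]

theorem transpose_centering (C : Finset (Fin n)) : (centering C)ᵀ = centering C := by
  simp [centering, Matrix.transpose_vecMulVec]

theorem transpose_projW (C₁ C₂ : Finset (Fin n)) : (projW C₁ C₂)ᵀ = projW C₁ C₂ := by
  simp [projW, transpose_centering]

theorem transpose_projB (C₁ C₂ : Finset (Fin n)) : (projB C₁ C₂)ᵀ = projB C₁ C₂ := by
  simp [projB, Matrix.transpose_vecMulVec]

theorem centering_mulVec_ind (h : C.Nonempty) : centering C *ᵥ ind C = 0 := by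
  have c : (C.card : ℝ) ≠ 0 := by simpa using h.ne_empty
  rw [centering, Matrix.sub_mulVec, diagonal_ind_mulVec_ind, Matrix.smul_mulVec,
    Matrix.vecMulVec_mulVec, ind_dotProduct_ind]
  ext i
  simp only [Pi.sub_apply, Pi.smul_apply, MulOpposite.smul_eq_mul_unop, MulOpposite.unop_op,
    smul_eq_mul, Pi.zero_apply]
  field_simp
  ring

theorem centering_mulVec_ind_of_disjoint (h : Disjoint C₁ C₂) : centering C₁ *ᵥ ind C₂ = 0 := by
  rw [centering, Matrix.sub_mulVec, Matrix.smul_mulVec,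
    Matrix.vecMulVec_mulVec, ind_dotProduct_ind_of_disjoint h]
  ext i
  simp [Matrix.mulVec_diagonal, ind_mul_ind_of_disjoint h]

theorem centering_mul_self (h : C.Nonempty) : centering C * centering C = centering C := by
  conv_lhs => rw [centering.eq_def C, Matrix.mul_sub, Matrix.mul_smul, Matrix.mul_vecMulVec]
  rw [← centering, centering_mulVec_ind h, Matrix.zero_vecMulVec, smul_zero, sub_zero]
  ext i j
  by_cases hj : j ∈ C <;>
    simp [Matrix.mul_diagonal, centering, Matrix.diagonal_apply, Matrix.vecMulVec_apply, ind, hj]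
  rintro rfl
  simpa using hj

theorem centering_mul_centering (h : Disjoint C₁ C₂) : centering C₁ * centering C₂ = 0 := by
  rw [centering.eq_def C₂, Matrix.mul_sub, Matrix.mul_smul, Matrix.mul_vecMulVec,
    centering_mulVec_ind_of_disjoint h, Matrix.zero_vecMulVec, smul_zero, sub_zero]
  ext i j
  have hij := ind_mul_ind_of_disjoint h j
  by_cases e : i = j
  · subst e
    simp only [centering, Matrix.mul_diagonal, Matrix.sub_apply, Matrix.diagonal_apply_eq,
      Matrix.smul_apply, Matrix.vecMulVec_apply, smul_eq_mul, Matrix.zero_apply]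
    linear_combination (1 - (C₁.card : ℝ)⁻¹ * ind C₁ i) * hij
  · simp only [centering, Matrix.mul_diagonal, Matrix.sub_apply, Matrix.diagonal_apply_ne _ e,
      Matrix.smul_apply, Matrix.vecMulVec_apply, smul_eq_mul, Matrix.zero_apply]
    linear_combination (-(C₁.card : ℝ)⁻¹ * ind C₁ i) * hij

theorem projW_mul_projB (h₁ : C₁.Nonempty) (h₂ : C₂.Nonempty) (h : Disjoint C₁ C₂) :
    projW C₁ C₂ * projB C₁ C₂ = 0 := by
  rw [projB, Matrix.mul_smul, Matrix.mul_vecMulVec, projW, Matrix.add_mulVec, nu_eq]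
  simp [Matrix.mulVec_sub, Matrix.mulVec_smul, centering_mulVec_ind h₁, centering_mulVec_ind h₂,
    centering_mulVec_ind_of_disjoint h, centering_mulVec_ind_of_disjoint h.symm]

theorem projB_mul_projW (h₁ : C₁.Nonempty) (h₂ : C₂.Nonempty) (h : Disjoint C₁ C₂) :
    projB C₁ C₂ * projW C₁ C₂ = 0 := by
  rw [← Matrix.transpose_inj, Matrix.transpose_mul, transpose_projW, transpose_projB,
    projW_mul_projB h₁ h₂ h, Matrix.transpose_zero]

theorem projW_mul_self (h₁ : C₁.Nonempty) (h₂ : C₂.Nonempty) (h : Disjoint C₁ C₂) :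
    projW C₁ C₂ * projW C₁ C₂ = projW C₁ C₂ := by
  simp [projW, mul_add, add_mul, centering_mul_self h₁, centering_mul_self h₂,
    centering_mul_centering h, centering_mul_centering h.symm]

theorem sum_nu_sq_pos (h₁ : C₁.Nonempty) (h₂ : C₂.Nonempty) (h : Disjoint C₁ C₂) :
    0 < ∑ i, nu C₁ C₂ i ^ 2 := by
  have c₁ : 0 < (C₁.card : ℝ) := by simpa [Finset.card_pos] using h₁
  have c₂ : 0 < (C₂.card : ℝ) := by simpa [Finset.card_pos] using h₂
  rw [sum_nu_sq h₁ h₂ h]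
  positivity

theorem projB_mul_self (h₁ : C₁.Nonempty) (h₂ : C₂.Nonempty) (h : Disjoint C₁ C₂) :
    projB C₁ C₂ * projB C₁ C₂ = projB C₁ C₂ := by
  have hS := (sum_nu_sq_pos h₁ h₂ h).ne'
  rw [projB, Matrix.mul_smul, Matrix.smul_mul, Matrix.vecMulVec_mul_vecMulVec, nu_dotProduct_self]
  ext i j
  simp only [Matrix.smul_apply, Matrix.vecMulVec_apply, Pi.smul_apply, smul_eq_mul]
  field_simp

theorem trace_projB (h₁ : C₁.Nonempty) (h₂ : C₂.Nonempty) (h : Disjoint C₁ C₂) :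
    (projB C₁ C₂).trace = 1 := by
  have hS := (sum_nu_sq_pos h₁ h₂ h).ne'
  rw [projB, Matrix.trace_smul, Matrix.trace_vecMulVec, nu_dotProduct_self, smul_eq_mul,
    inv_mul_cancel₀ hS]

theorem trace_centering (h : C.Nonempty) : (centering C).trace = C.card - 1 := by
  have c : (C.card : ℝ) ≠ 0 := by simpa using h.ne_empty
  rw [centering, Matrix.trace_sub, Matrix.trace_smul, Matrix.trace_vecMulVec, ind_dotProduct_ind,
    smul_eq_mul, inv_mul_cancel₀ c, Matrix.trace_diagonal]
  simp [ind]

theorem trace_projW (h₁ : C₁.Nonempty) (h₂ : C₂.Nonempty) :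
    (projW C₁ C₂).trace = pairSize C₁ C₂ - 2 := by
  rw [projW, Matrix.trace_add, trace_centering h₁, trace_centering h₂, pairSize]
  ring

theorem projB_mul_apply (x : Matrix (Fin n) (Fin p) ℝ) (i : Fin n) (j : Fin p) :
    (projB C₁ C₂ * x) i j =
      (∑ i, nu C₁ C₂ i ^ 2)⁻¹ * (nu C₁ C₂ i * (clusterMean C₁ x j - clusterMean C₂ x j)) := by
  have e : ∑ k, nu C₁ C₂ k * x k j = clusterMean C₁ x j - clusterMean C₂ x j := by
    simp [nu, clusterMean, ind, sub_mul, Finset.sum_sub_distrib, ite_div, ite_mul, Finset.sum_div]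
    simp only [div_eq_inv_mul]
  rw [← e, projB, Matrix.smul_mul, Matrix.smul_apply, Matrix.mul_apply, smul_eq_mul]
  simp [Matrix.vecMulVec_apply, mul_assoc, Finset.mul_sum]

theorem centering_mul_apply (x : Matrix (Fin n) (Fin p) ℝ) (i : Fin n) (j : Fin p) :
    (centering C * x) i j = ind C i * (x i j - clusterMean C x j) := by
  rw [centering, Matrix.sub_mul, Matrix.sub_apply, Matrix.diagonal_mul, Matrix.smul_mul,
    Matrix.smul_apply, Matrix.mul_apply]
  have e : ∑ k, Matrix.vecMulVec (ind C) (ind C) i k * x k j = ind C i * ∑ k ∈ C, x k j := by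
    simp [Matrix.vecMulVec_apply, ind, Finset.mul_sum]
  rw [e, smul_eq_mul, clusterMean]
  ring

theorem bcss_eq_frobSq (h₁ : C₁.Nonempty) (h₂ : C₂.Nonempty) (h : Disjoint C₁ C₂)
    (x : Matrix (Fin n) (Fin p) ℝ) : bcss C₁ C₂ x = frobSq (projB C₁ C₂ * x) := by
  have c₁ : 0 < (C₁.card : ℝ) := by simpa [Finset.card_pos] using h₁
  have c₂ : 0 < (C₂.card : ℝ) := by simpa [Finset.card_pos] using h₂
  have e : frobSq (projB C₁ C₂ * x) = (∑ i, nu C₁ C₂ i ^ 2)⁻¹ *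
      ∑ j, (clusterMean C₁ x j - clusterMean C₂ x j) ^ 2 := by
    have hS := (sum_nu_sq_pos h₁ h₂ h).ne'
    simp only [frobSq, projB_mul_apply, mul_pow]
    simp only [← Finset.mul_sum, ← Finset.sum_mul]
    field_simp
  rw [e, bcss, sum_nu_sq h₁ h₂ h, pairSize]
  congr 1
  field_simp
  ring

theorem wcss_eq_frobSq (h : Disjoint C₁ C₂)
    (x : Matrix (Fin n) (Fin p) ℝ) : wcss C₁ C₂ x = frobSq (projW C₁ C₂ * x) := by
  have e : ∀ i j, (projW C₁ C₂ * x) i j ^ 2 =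
      (if i ∈ C₁ then (x i j - clusterMean C₁ x j) ^ 2 else 0) +
        (if i ∈ C₂ then (x i j - clusterMean C₂ x j) ^ 2 else 0) := by
    intro i j
    rw [projW, Matrix.add_mul, Matrix.add_apply, centering_mul_apply, centering_mul_apply]
    by_cases h1 : i ∈ C₁
    · simp [ind, h1, Finset.disjoint_left.1 h h1]
    · simp [ind, h1]
  have e' : ∀ (C : Finset (Fin n)) (g : Fin n → Fin p → ℝ),
      ∑ i, ∑ j, (if i ∈ C then g i j else 0) = ∑ i ∈ C, ∑ j, g i j := by
    intro C g
    rw [Finset.sum_comm, Finset.sum_comm (s := C)]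
    simp
  simp only [frobSq, e, Finset.sum_add_distrib, wcss, e']

theorem frobSq_eq_trace (x : Matrix (Fin n) (Fin p) ℝ) : frobSq x = (xᵀ * x).trace := by
  simp only [frobSq, Matrix.trace, Matrix.diag_apply, Matrix.mul_apply, Matrix.transpose_apply]
  rw [Finset.sum_comm]
  simp [sq]

theorem frobSq_mul_of_projection {S : Matrix (Fin n) (Fin n) ℝ} (hS : Sᵀ = S) (hSS : S * S = S)
    (x : Matrix (Fin n) (Fin p) ℝ) : frobSq (S * x) = (xᵀ * (S * x)).trace := by
  rw [frobSq_eq_trace, Matrix.transpose_mul, hS, Matrix.mul_assoc, ← Matrix.mul_assoc S, hSS]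

/-- Pythagoras' theorem for the decomposition of a data matrix by the two projections. -/
theorem frobSq_eq_add (h₁ : C₁.Nonempty) (h₂ : C₂.Nonempty) (h : Disjoint C₁ C₂)
    (x : Matrix (Fin n) (Fin p) ℝ) :
    frobSq x = frobSq (projB C₁ C₂ * x) + frobSq (projW C₁ C₂ * x) +
      frobSq (x - projB C₁ C₂ * x - projW C₁ C₂ * x) := by
  have e : x - projB C₁ C₂ * x - projW C₁ C₂ * x = (1 - projB C₁ C₂ - projW C₁ C₂) * x := by
    simp [Matrix.sub_mul]
  rw [e, frobSq_mul_of_projection (transpose_projB _ _) (projB_mul_self h₁ h₂ h),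
    frobSq_mul_of_projection (transpose_projW _ _) (projW_mul_self h₁ h₂ h),
    frobSq_mul_of_projection (S := 1 - projB C₁ C₂ - projW C₁ C₂), frobSq_eq_trace,
    ← Matrix.trace_add, ← Matrix.trace_add, ← e]
  · congr 1
    simp only [Matrix.mul_sub]
    abel
  · simp [transpose_projB, transpose_projW]
  · simp [sub_mul, mul_sub, projB_mul_self h₁ h₂ h, projW_mul_self h₁ h₂ h,
      projB_mul_projW h₁ h₂ h, projW_mul_projB h₁ h₂ h]

end Projections

section LeftMultiplication

variable {n : ℕ} (p : ℕ)

theorem trace_mulLeftLinearMap (S : Matrix (Fin n) (Fin n) ℝ) :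
    LinearMap.trace ℝ _ (mulLeftLinearMap (Fin p) ℝ S) = p * S.trace := by
  rw [LinearMap.trace_eq_matrix_trace ℝ (Matrix.stdBasis ℝ (Fin n) (Fin p)), Matrix.trace]
  simp only [Matrix.diag_apply, LinearMap.toMatrix_apply]
  rw [Fintype.sum_prod_type]
  have : ∀ (i : Fin n) (j : Fin p), ((Matrix.stdBasis ℝ (Fin n) (Fin p)).repr
      ((mulLeftLinearMap (Fin p) ℝ S) ((Matrix.stdBasis ℝ (Fin n) (Fin p)) (i, j)))) (i, j) = S i i := by
    intro i j
    rw [Matrix.stdBasis_eq_single]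
    change (S * (Matrix.single i j 1 : Matrix (Fin n) (Fin p) ℝ) : Matrix _ _ ℝ) i j = S i i
    simp
  simp only [this]
  simp [Matrix.trace, Finset.mul_sum]

/-- The rank of a projection is its trace. -/
theorem finrank_range_mulLeftLinearMap {S : Matrix (Fin n) (Fin n) ℝ} (hS : S * S = S) :
    (Module.finrank ℝ (LinearMap.range (mulLeftLinearMap (Fin p) ℝ S)) : ℝ) = p * S.trace := by
  rw [← trace_mulLeftLinearMap, LinearMap.IsProj.trace (p := LinearMap.range (mulLeftLinearMap (Fin p) ℝ S))]
  refine ⟨fun x => ⟨x, rfl⟩, ?_⟩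
  rintro _ ⟨y, rfl⟩
  simp only [mulLeftLinearMap_apply, ← Matrix.mul_assoc, hS]

end LeftMultiplication

section Clusters

variable {n : ℕ}

theorem clusters_nonempty_disjoint (m : ℕ → Merge n) (s : ℕ)
    (hm : ∀ j < s, m j ∈ candidates (clusters m j)) :
    (∀ C ∈ clusters m s, C.Nonempty) ∧
      ∀ C ∈ clusters m s, ∀ C' ∈ clusters m s, C ≠ C' → Disjoint C C' := by
  induction s with
  | zero =>
    simp only [clusters, Finset.mem_image, Finset.mem_univ, true_and]
    refine ⟨?_, ?_⟩
    · rintro _ ⟨i, rfl⟩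
      exact Finset.singleton_nonempty i
    · rintro _ ⟨i, rfl⟩ _ ⟨j, rfl⟩ hij
      simpa using fun h => hij (by rw [h])
  | succ s ih =>
    obtain ⟨hne, hdisj⟩ := ih fun j hj => hm j (by omega)
    have hs := hm s (by omega)
    generalize hM : m s = M at hs
    induction M using Sym2.ind with | _ A B
    simp only [candidates, Finset.mem_filter, Finset.mk_mem_sym2_iff, Sym2.mk_isDiag_iff]
      at hs
    obtain ⟨⟨hA, hB⟩, hAB⟩ := hs
    have hmem : ∀ C ∈ clusters m (s + 1), C = A ∪ B ∨ (C ∈ clusters m s ∧ C ≠ A ∧ C ≠ B) := by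
      intro C hC
      simpa [clusters, hM] using hC
    refine ⟨fun C hC => ?_, fun C hC C' hC' hne' => ?_⟩
    · rcases hmem C hC with rfl | ⟨h, -⟩
      · exact (hne A hA).mono Finset.subset_union_left
      · exact hne C h
    · rcases hmem C hC with rfl | ⟨h, h1, h2⟩ <;> rcases hmem C' hC' with rfl | ⟨h', h1', h2'⟩
      · exact absurd rfl hne'
      · exact Finset.disjoint_union_left.2
          ⟨hdisj A hA C' h' (Ne.symm h1'), hdisj B hB C' h' (Ne.symm h2')⟩
      · exact Finset.disjoint_union_right.2 ⟨hdisj C h A hA h1, hdisj C h B hB h2⟩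
      · exact hdisj C h C' h' hne'

end Clusters

/-! ### The `F` density and the matrix normal law -/

section FDistribution

/-- The measure on `(0, ∞)` with density `fDensity a b`. -/
def fMeasure (a b : ℝ) : Measure ℝ :=
  (volume.restrict (Ioi 0)).withDensity fun r => ENNReal.ofReal (fDensity a b r)

@[fun_prop]
theorem measurable_fDensity (a b : ℝ) : Measurable (fDensity a b) := by
  unfold fDensity
  exact Measurable.ite measurableSet_Ioi (by fun_prop) measurable_const

theorem fDensity_pos {a b : ℝ} (ha : 0 < a) (hb : 0 < b) {r : ℝ} (hr : 0 < r) :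
    0 < fDensity a b r := by
  have := beta_pos (half_pos ha) (half_pos hb)
  rw [fDensity, if_pos hr]
  positivity

theorem lintegral_Ioi_mul_sq {c : ℝ} (hc : 0 < c) (g : ℝ → ℝ≥0∞) :
    ∫⁻ r in Ioi (0 : ℝ), g r = ∫⁻ s in Ioi (0 : ℝ), ENNReal.ofReal (2 * c * s) * g (c * s ^ 2) := by
  have h := lintegral_image_eq_lintegral_abs_deriv_mul (s := Ioi (0 : ℝ))
    (f := fun x => c * x ^ 2) (f' := fun x => c * (2 * x)) measurableSet_Ioi
    (fun x _ => by simpa using ((hasDerivAt_pow 2 x).const_mul c).hasDerivWithinAt)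
    (fun x hx y hy hxy => (pow_left_inj₀ (le_of_lt hx) (le_of_lt hy) two_ne_zero).1
      (mul_left_cancel₀ hc.ne' hxy)) g
  have him : (fun x => c * x ^ 2) '' Ioi (0 : ℝ) = Ioi 0 := by
    ext r
    constructor
    · rintro ⟨s, hs, rfl⟩
      have : (0 : ℝ) < s := hs
      exact mem_Ioi.2 (by positivity)
    · intro hr
      have hr' : (0 : ℝ) < r := hr
      refine ⟨√(r / c), mem_Ioi.2 (by positivity), ?_⟩
      simp only
      rw [Real.sq_sqrt (by positivity)]
      field_simp
  rw [him] at h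
  rw [h]
  refine setLIntegral_congr_fun measurableSet_Ioi fun s hs => ?_
  have hs' : (0 : ℝ) < s := hs
  rw [abs_of_pos (by positivity)]
  congr 2
  ring

/-- The substitution `r = c s²` turns `ratioDensity k l`, where `l = c k`, into a multiple of the
`F` density with `k` and `l` degrees of freedom. -/
theorem exists_ratioDensity_eq {k l : ℕ} {c : ℝ} (hc : 0 < c) (hk : 0 < k) (hl : (l : ℝ) = c * k) :
    ∃ K : ℝ, 0 < K ∧ ∀ s : ℝ, 0 < s →
      ratioDensity k l s = K * (2 * c * s * fDensity k (c * k) (c * s ^ 2)) := by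
  have hk' : (0 : ℝ) < k := Nat.cast_pos.2 hk
  have hβ : 0 < beta ((k : ℝ) / 2) (c * k / 2) := beta_pos (by positivity) (by positivity)
  refine ⟨(2 * c * (beta ((k : ℝ) / 2) (c * k / 2))⁻¹ * ((k : ℝ) / (c * k)) ^ ((k : ℝ) / 2) *
    c ^ ((k : ℝ) / 2 - 1))⁻¹, by positivity, fun s hs => ?_⟩
  have e1 : (c * s ^ 2) ^ ((k : ℝ) / 2 - 1) = c ^ ((k : ℝ) / 2 - 1) * s ^ ((k : ℝ) - 2) := by
    rw [Real.mul_rpow hc.le (by positivity), ← Real.rpow_natCast_mul hs.le]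
    congr 2
    push_cast
    ring
  have e2 : s ^ (k - 1) = s * s ^ ((k : ℝ) - 2) := by
    nth_rw 2 [← Real.rpow_one s]
    rw [← Real.rpow_natCast, ← Real.rpow_add hs, Nat.cast_sub hk]
    congr 1
    push_cast
    ring
  have e3 : (1 + (k : ℝ) / (c * k) * (c * s ^ 2)) ^ (-(((k : ℝ) + c * k) / 2)) =
      (√(1 + s ^ 2))⁻¹ ^ (k + l) := by
    have : (1 + (k : ℝ) / (c * k) * (c * s ^ 2)) = 1 + s ^ 2 := by field_simp
    rw [this, ← hl, Real.sqrt_eq_rpow, ← Real.rpow_neg (by positivity),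
      ← Real.rpow_natCast _ (k + l), ← Real.rpow_mul (by positivity)]
    congr 1
    push_cast
    ring
  rw [fDensity, if_pos (by positivity), e1, e3, ratioDensity, e2]
  have h1 : c ^ ((k : ℝ) / 2 - 1) ≠ 0 := by positivity
  have h2 : ((k : ℝ) / (c * k)) ^ ((k : ℝ) / 2) ≠ 0 := by positivity
  generalize beta ((k : ℝ) / 2) (c * k / 2) = β at hβ ⊢
  field_simp

theorem exists_map_ratioDensity_eq {k l : ℕ} {c : ℝ} (hc : 0 < c) (hk : 0 < k)
    (hl : (l : ℝ) = c * k) :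
    ∃ K : ℝ≥0∞, K ≠ 0 ∧ K ≠ ∞ ∧
      ((volume.restrict (Ioi 0)).withDensity fun s => ENNReal.ofReal (ratioDensity k l s)).map
        (fun s => c * s ^ 2) = K • fMeasure k (c * k) := by
  obtain ⟨K, hK, h⟩ := exists_ratioDensity_eq hc hk hl
  refine ⟨ENNReal.ofReal K, by simpa using hK, ENNReal.ofReal_ne_top, ?_⟩
  refine Measure.ext_of_lintegral _ fun f hf => ?_
  rw [lintegral_map hf (by fun_prop),
    lintegral_withDensity_eq_lintegral_mul _ (by fun_prop) (by fun_prop),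
    lintegral_smul_measure, fMeasure,
    lintegral_withDensity_eq_lintegral_mul _ (by fun_prop) (by fun_prop)]
  simp only [Pi.mul_apply]
  rw [lintegral_Ioi_mul_sq hc fun r => ENNReal.ofReal (fDensity k (c * k) r) * f r, smul_eq_mul, ← lintegral_const_mul' _ _ ENNReal.ofReal_ne_top]
  refine setLIntegral_congr_fun measurableSet_Ioi fun s hs => ?_
  have hs' : (0 : ℝ) < s := hs
  have hf0 : 0 < fDensity k (c * k) (c * s ^ 2) :=
    fDensity_pos (Nat.cast_pos.2 hk) (mul_pos hc (Nat.cast_pos.2 hk)) (by positivity)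
  simp only [← mul_assoc]
  rw [h s hs', ENNReal.ofReal_mul hK.le, ENNReal.ofReal_mul (by positivity), ← mul_assoc]

end FDistribution

section MatrixNormal

attribute [local instance] Matrix.frobeniusNormedAddCommGroup Matrix.frobeniusNormedSpace

variable {n p : ℕ}

/-- The topology of the Frobenius norm is the product topology, so its Borel sets are those of the
product sigma-algebra. -/
instance instBorelSpaceMatrix (m n : ℕ) :
    @BorelSpace (Matrix (Fin m) (Fin n) ℝ)
      PseudoMetricSpace.toUniformSpace.toTopologicalSpace _ :=
  inferInstanceAs (BorelSpace (Fin m → Fin n → ℝ))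

/-- Lebesgue measure on the space of data matrices. -/
def matrixVolume (n p : ℕ) : Measure (Matrix (Fin n) (Fin p) ℝ) :=
  Measure.pi fun _ => Measure.pi fun _ => volume

theorem isAddHaarMeasure_matrixVolume :
    @Measure.IsAddHaarMeasure (Matrix (Fin n) (Fin p) ℝ) _ UniformSpace.toTopologicalSpace _
      (matrixVolume n p) :=
  have : (Measure.pi fun _ : Fin p => (volume : Measure ℝ)).IsAddHaarMeasure := inferInstance
  Measure.pi.isAddHaarMeasure fun _ : Fin n => Measure.pi fun _ : Fin p => (volume : Measure ℝ)

theorem norm_eq_sqrt_frobSq (x : Matrix (Fin n) (Fin p) ℝ) : ‖x‖ = √(frobSq x) := by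
  rw [Matrix.frobenius_norm_def, Real.sqrt_eq_rpow, frobSq]
  simp

theorem frobSq_nonneg (x : Matrix (Fin n) (Fin p) ℝ) : 0 ≤ frobSq x :=
  Finset.sum_nonneg fun _ _ => Finset.sum_nonneg fun _ _ => sq_nonneg _

theorem norm_sq_eq_frobSq (x : Matrix (Fin n) (Fin p) ℝ) : ‖x‖ ^ 2 = frobSq x := by
  rw [norm_eq_sqrt_frobSq, Real.sq_sqrt (frobSq_nonneg x)]

instance isProbabilityMeasure_matrixNormal (μ : Matrix (Fin n) (Fin p) ℝ) (σ : ℝ≥0) :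
    IsProbabilityMeasure (matrixNormal μ σ) := by
  have : ∀ i, IsProbabilityMeasure (Measure.pi fun j => gaussianReal (μ i j) (σ ^ 2)) :=
    fun i => inferInstance
  exact Measure.pi.instIsProbabilityMeasure _

theorem exists_matrixNormal_eq_withDensity (μ : Matrix (Fin n) (Fin p) ℝ) {σ : ℝ≥0} (hσ : 0 < σ) :
    ∃ (C : ℝ≥0) (a : ℝ), matrixNormal μ σ = (matrixVolume n p).withDensity fun x =>
      C * ENNReal.ofReal (Real.exp (-(a * ‖x - μ‖ ^ 2))) := by
  have hv : σ ^ 2 ≠ 0 := by positivity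
  have h1 : ∀ i j, gaussianReal (μ i j) (σ ^ 2) =
      volume.withDensity (gaussianPDF (μ i j) (σ ^ 2)) := fun i j =>
    gaussianReal_of_var_ne_zero _ hv
  have h2 : ∀ i, Measure.pi (fun j => gaussianReal (μ i j) (σ ^ 2)) =
      (Measure.pi fun _ : Fin p => (volume : Measure ℝ)).withDensity
        (fun y => ∏ j, gaussianPDF (μ i j) (σ ^ 2) (y j)) := by
    intro i
    have : ∀ j, SigmaFinite ((volume : Measure ℝ).withDensity (gaussianPDF (μ i j) (σ ^ 2))) :=
      fun j => by rw [← h1]; infer_instance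
    simp_rw [h1]
    exact pi_withDensity_fin _ _ fun j => measurable_gaussianPDF _ _
  have h3 : matrixNormal μ σ = (Measure.pi fun _ : Fin n => Measure.pi fun _ : Fin p =>
      (volume : Measure ℝ)).withDensity
        (fun x => ∏ i, ∏ j, gaussianPDF (μ i j) (σ ^ 2) (x i j)) := by
    have : ∀ i, SigmaFinite ((Measure.pi fun _ : Fin p => (volume : Measure ℝ)).withDensity
        (fun y => ∏ j, gaussianPDF (μ i j) (σ ^ 2) (y j))) :=
      fun i => by rw [← h2]; infer_instance
    unfold matrixNormal
    simp_rw [h2]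
    exact pi_withDensity_fin _ (fun i (y : Fin p → ℝ) => ∏ j, gaussianPDF (μ i j) (σ ^ 2) (y j))
      fun i => Finset.measurable_prod _ fun j _ =>
      (measurable_gaussianPDF _ _).comp (measurable_pi_apply j)
  refine ⟨∏ _i : Fin n, ∏ _j : Fin p, (√(2 * Real.pi * (σ ^ 2 : ℝ≥0)))⁻¹.toNNReal,
    (2 * (σ ^ 2 : ℝ≥0))⁻¹, ?_⟩
  rw [h3]
  change (matrixVolume n p).withDensity _ = _
  refine congrArg _ (funext fun x : Matrix (Fin n) (Fin p) ℝ => ?_)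
  have h4 : Real.exp (-((2 * ((σ ^ 2 : ℝ≥0) : ℝ))⁻¹ * ‖x - μ‖ ^ 2)) =
      ∏ i, ∏ j, Real.exp (-(x i j - μ i j) ^ 2 / (2 * (σ ^ 2 : ℝ≥0))) := by
    simp only [← Real.exp_sum]
    rw [norm_sq_eq_frobSq, frobSq, Finset.mul_sum, ← Finset.sum_neg_distrib]
    congr 1
    refine Finset.sum_congr rfl fun i _ => ?_
    rw [Finset.mul_sum, ← Finset.sum_neg_distrib]
    refine Finset.sum_congr rfl fun j _ => ?_
    rw [Matrix.sub_apply]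
    ring
  rw [h4, ENNReal.ofReal_prod_of_nonneg fun i _ => Finset.prod_nonneg fun j _ => Real.exp_nonneg _]
  simp only [ENNReal.ofNNReal_finsetProd, ← Finset.prod_mul_distrib]
  refine Finset.prod_congr rfl fun i _ => ?_
  rw [ENNReal.ofReal_prod_of_nonneg fun j _ => Real.exp_nonneg _, ← Finset.prod_mul_distrib]
  refine Finset.prod_congr rfl fun j _ => ?_
  rw [gaussianPDF, gaussianPDFReal, ENNReal.ofReal_mul (by positivity)]
  rfl

end MatrixNormal

/-! ### The joint law of the test statistic and the auxiliary statistics -/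

section JointLaw

attribute [local instance] Matrix.frobeniusNormedAddCommGroup Matrix.frobeniusNormedSpace

variable {n p : ℕ} {C₁ C₂ : Finset (Fin n)}

theorem isOrthogonalPair_mulLeft (p : ℕ) (h₁ : C₁.Nonempty) (h₂ : C₂.Nonempty)
    (h : Disjoint C₁ C₂) :
    IsOrthogonalPair (mulLeftLinearMap (Fin p) ℝ (projB C₁ C₂))
      (mulLeftLinearMap (Fin p) ℝ (projW C₁ C₂)) where
  BB x := by simp [← Matrix.mul_assoc, projB_mul_self h₁ h₂ h]
  WW x := by simp [← Matrix.mul_assoc, projW_mul_self h₁ h₂ h]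
  BW x := by simp [← Matrix.mul_assoc, projB_mul_projW h₁ h₂ h]
  WB x := by simp [← Matrix.mul_assoc, projW_mul_projB h₁ h₂ h]
  pythagoras x := by
    simp only [norm_sq_eq_frobSq, mulLeftLinearMap_apply]
    exact frobSq_eq_add h₁ h₂ h x

theorem polarStat_mulLeft_snd (x : Matrix (Fin n) (Fin p) ℝ) :
    (polarStat (mulLeftLinearMap (Fin p) ℝ (projB C₁ C₂))
      (mulLeftLinearMap (Fin p) ℝ (projW C₁ C₂)) x).2 = auxStat C₁ C₂ x := by
  simp [polarStat, auxStat, dir, norm_eq_sqrt_frobSq, Real.sq_sqrt (frobSq_nonneg _),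
    Matrix.sub_mul]

/-- The identity holds for every `x`: if `W x = 0`, both sides are `0` by the convention for division
by zero. -/
theorem polarStat_mulLeft_fst (h₁ : C₁.Nonempty) (h₂ : C₂.Nonempty) (h : Disjoint C₁ C₂)
    (x : Matrix (Fin n) (Fin p) ℝ) :
    (pairSize C₁ C₂ - 2) * (polarStat (mulLeftLinearMap (Fin p) ℝ (projB C₁ C₂))
      (mulLeftLinearMap (Fin p) ℝ (projW C₁ C₂)) x).1 ^ 2 = testStat C₁ C₂ x := by
  simp [polarStat, testStat, norm_eq_sqrt_frobSq, div_pow, Real.sq_sqrt (frobSq_nonneg _),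
    bcss_eq_frobSq h₁ h₂ h, wcss_eq_frobSq h]

theorem measurable_auxStat : Measurable (auxStat (p := p) C₁ C₂) := by
  have e := funext (polarStat_mulLeft_snd (p := p) (C₁ := C₁) (C₂ := C₂))
  rw [← e]
  exact measurable_snd.comp measurable_polarStat

theorem measurable_testStat (h₁ : C₁.Nonempty) (h₂ : C₂.Nonempty) (h : Disjoint C₁ C₂) :
    Measurable (testStat (p := p) C₁ C₂) := by
  rw [← funext (polarStat_mulLeft_fst (p := p) h₁ h₂ h)]
  exact ((measurable_fst.comp measurable_polarStat).pow_const 2).const_mul _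

theorem clusterMean_eq_of_const (hC : C₁.Nonempty) {μ : Matrix (Fin n) (Fin p) ℝ}
    {i₀ : Fin n} (h : ∀ i ∈ C₁, μ i = μ i₀) (j : Fin p) : clusterMean C₁ μ j = μ i₀ j := by
  have c : (C₁.card : ℝ) ≠ 0 := by simpa using hC.ne_empty
  rw [clusterMean, Finset.sum_congr rfl fun i hi => congrFun (h i hi) j]
  simp [c]

theorem projB_mul_eq_zero (h₁ : C₁.Nonempty) (h₂ : C₂.Nonempty)
    {μ : Matrix (Fin n) (Fin p) ℝ} (hnull : ∀ i ∈ C₁ ∪ C₂, ∀ i' ∈ C₁ ∪ C₂, μ i = μ i') :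
    projB C₁ C₂ * μ = 0 := by
  obtain ⟨i₀, hi₀⟩ := h₁
  have hi₀' := Finset.mem_union_left C₂ hi₀
  ext i j
  rw [projB_mul_apply, clusterMean_eq_of_const ⟨i₀, hi₀⟩ fun k hk =>
    hnull k (Finset.mem_union_left _ hk) i₀ hi₀', clusterMean_eq_of_const h₂ fun k hk =>
    hnull k (Finset.mem_union_right _ hk) i₀ hi₀']
  simp

theorem projW_mul_eq_zero (h₁ : C₁.Nonempty) (h₂ : C₂.Nonempty)
    {μ : Matrix (Fin n) (Fin p) ℝ} (hnull : ∀ i ∈ C₁ ∪ C₂, ∀ i' ∈ C₁ ∪ C₂, μ i = μ i') :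
    projW C₁ C₂ * μ = 0 := by
  have key : ∀ C ⊆ C₁ ∪ C₂, C.Nonempty → centering C * μ = 0 := by
    rintro C hC ⟨i₀, hi₀⟩
    ext i j
    rw [centering_mul_apply, clusterMean_eq_of_const ⟨i₀, hi₀⟩ fun k hk =>
      hnull k (hC hk) i₀ (hC hi₀)]
    by_cases hi : i ∈ C
    · simp [hnull i (hC hi) i₀ (hC hi₀)]
    · simp [ind, hi]
  rw [projW, Matrix.add_mul, key C₁ Finset.subset_union_left h₁,
    key C₂ Finset.subset_union_right h₂, add_zero]

/-- Under the null hypothesis the test statistic is independent of the auxiliary statistics and has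
a law proportional to `fMeasure`, the `F` distribution. -/
theorem exists_map_auxStat_testStat (hp : 0 < p) (h₁ : C₁.Nonempty) (h₂ : C₂.Nonempty)
    (h : Disjoint C₁ C₂) (hN : 3 ≤ C₁.card + C₂.card) {μ : Matrix (Fin n) (Fin p) ℝ}
    (hnull : ∀ i ∈ C₁ ∪ C₂, ∀ i' ∈ C₁ ∪ C₂, μ i = μ i') {σ : ℝ≥0} (hσ : 0 < σ) :
    ∃ K : ℝ≥0∞, K ≠ 0 ∧ K ≠ ∞ ∧
      IsProbabilityMeasure (K • fMeasure p ((pairSize C₁ C₂ - 2) * p)) ∧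
      (matrixNormal μ σ).map (fun x => (auxStat C₁ C₂ x, testStat C₁ C₂ x)) =
        ((matrixNormal μ σ).map (auxStat C₁ C₂)).prod
          (K • fMeasure p ((pairSize C₁ C₂ - 2) * p)) := by
  set c := pairSize C₁ C₂ - 2 with hc_def
  have hc : 0 < c := by
    have : (3 : ℝ) ≤ pairSize C₁ C₂ := by unfold pairSize; exact_mod_cast hN
    rw [hc_def]; linarith
  have hp' : (0 : ℝ) < p := Nat.cast_pos.2 hp
  have hk : Module.finrank ℝ (LinearMap.range (mulLeftLinearMap (Fin p) ℝ (projB C₁ C₂))) = p := by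
    have := finrank_range_mulLeftLinearMap p (projB_mul_self h₁ h₂ h)
    rw [trace_projB h₁ h₂ h, mul_one] at this
    exact_mod_cast this
  have hl : (Module.finrank ℝ (LinearMap.range (mulLeftLinearMap (Fin p) ℝ (projW C₁ C₂))) : ℝ) =
      c * p := by
    rw [finrank_range_mulLeftLinearMap p (projW_mul_self h₁ h₂ h), trace_projW h₁ h₂, mul_comm]
  set l := Module.finrank ℝ (LinearMap.range (mulLeftLinearMap (Fin p) ℝ (projW C₁ C₂)))
  have hl0 : 0 < l := by
    have : (0 : ℝ) < l := by rw [hl]; positivity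
    exact_mod_cast this
  obtain ⟨C, a, hγ⟩ := exists_matrixNormal_eq_withDensity μ hσ
  obtain ⟨Q, hQ, hprod⟩ := (isOrthogonalPair_mulLeft p h₁ h₂ h).exists_map_polarStat_eq_prod
    (hvol := isAddHaarMeasure_matrixVolume)
    (by rw [hk]; exact hp) hl0 (matrixVolume n p) C a
    (projB_mul_eq_zero h₁ h₂ hnull) (projW_mul_eq_zero h₁ h₂ hnull)
  rw [← hγ, hk] at hprod
  obtain ⟨K₀, hK₀, hK₀', hmap⟩ := exists_map_ratioDensity_eq hc hp hl
  have hF : SFinite (fMeasure p (c * p)) := by unfold fMeasure; infer_instance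
  have hpair : (matrixNormal μ σ).map (fun x => (auxStat C₁ C₂ x, testStat C₁ C₂ x)) =
      Q.prod (K₀ • fMeasure p (c * p)) := by
    have e : (fun x : Matrix (Fin n) (Fin p) ℝ => (auxStat C₁ C₂ x, testStat C₁ C₂ x)) =
        Prod.swap ∘ (Prod.map (fun s => c * s ^ 2) id) ∘
        polarStat (mulLeftLinearMap (Fin p) ℝ (projB C₁ C₂))
          (mulLeftLinearMap (Fin p) ℝ (projW C₁ C₂)) := by
      ext1 x
      simp only [Function.comp_apply, Prod.map, Prod.swap, id, polarStat_mulLeft_snd,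
        polarStat_mulLeft_fst h₁ h₂ h, hc_def]
    rw [e, ← Measure.map_map measurable_swap (by
        exact (Measurable.prodMap (by fun_prop) measurable_id).comp measurable_polarStat),
      ← Measure.map_map (Measurable.prodMap (by fun_prop) measurable_id) measurable_polarStat,
      hprod, ← Measure.map_prod_map _ _ (by fun_prop) measurable_id, Measure.map_id, hmap,
      Measure.prod_swap]
  have hfst : (matrixNormal μ σ).map (auxStat C₁ C₂) = (K₀ • fMeasure p (c * p)) univ • Q := by
    have := congrArg Measure.fst hpair
    rwa [Measure.fst_map_prodMk (measurable_testStat h₁ h₂ h), Measure.fst,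
      Measure.map_fst_prod] at this
  -- both sides have mass one, which fixes the normalizing constant
  have hone : (K₀ • fMeasure p (c * p)) univ * Q univ = 1 := by
    have : ((matrixNormal μ σ).map (auxStat C₁ C₂)) univ = 1 := by
      rw [Measure.map_apply measurable_auxStat .univ]; simp
    rwa [hfst] at this
  set T := (K₀ • fMeasure p (c * p)) univ
  have hT0 : T ≠ 0 := by rintro h0; simp [h0] at hone
  have hQ0 : Q univ ≠ 0 := by rintro h0; simp [h0] at hone
  have hT1 : T ≠ ∞ := by
    rintro h0; rw [h0, ENNReal.top_mul hQ0] at hone; exact ENNReal.top_ne_one hone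
  refine ⟨T⁻¹ * K₀, mul_ne_zero (ENNReal.inv_ne_zero.2 hT1) hK₀,
    ENNReal.mul_ne_top (ENNReal.inv_ne_top.2 hT0) hK₀', ⟨?_⟩, ?_⟩
  · rw [mul_smul, Measure.smul_apply, smul_eq_mul, ENNReal.inv_mul_cancel hT0 hT1]
  · simp only [hpair, hfst, Measure.prod_smul_left, Measure.prod_smul_right, smul_smul]
    rw [mul_right_comm, ENNReal.inv_mul_cancel hT0 hT1, one_mul]

end JointLaw

section Reconstruction

variable {n p : ℕ} {C₁ C₂ : Finset (Fin n)}

/-- Positivity of the test statistic excludes the data with vanishing between- or within-cluster sum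
of squares, for which a direction is lost. -/
theorem reconstruct_auxStat (h₁ : C₁.Nonempty) (h₂ : C₂.Nonempty) (h : Disjoint C₁ C₂)
    (hN : 3 ≤ C₁.card + C₂.card) {x : Matrix (Fin n) (Fin p) ℝ} (hx : 0 < testStat C₁ C₂ x) :
    reconstruct C₁ C₂ (testStat C₁ C₂ x) (auxStat C₁ C₂ x) = x := by
  set c := pairSize C₁ C₂ - 2 with hc_def
  have hc : 0 < c := by
    have : (3 : ℝ) ≤ pairSize C₁ C₂ := by unfold pairSize; exact_mod_cast hN
    rw [hc_def]; linarith
  set b := frobSq (projB C₁ C₂ * x) with hb_def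
  set w := frobSq (projW C₁ C₂ * x) with hw_def
  have hR : testStat C₁ C₂ x = c * (b / w) := by
    rw [testStat, bcss_eq_frobSq h₁ h₂ h, wcss_eq_frobSq h]
  have hb0 : 0 ≤ b := frobSq_nonneg _
  have hw0 : 0 ≤ w := frobSq_nonneg _
  have hb : 0 < b := hb0.lt_of_ne fun e => by rw [hR, ← e] at hx; simp at hx
  have hw : 0 < w := hw0.lt_of_ne fun e => by rw [hR, ← e] at hx; simp at hx
  have e1 : √(b + w) * (√(c * (b / w) / (c + c * (b / w))) * (√b)⁻¹) = 1 := by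
    have : c * (b / w) / (c + c * (b / w)) = b / (b + w) := by field_simp; ring
    rw [this, Real.sqrt_div hb0]
    field_simp
  have e2 : √(b + w) * (√(c / (c + c * (b / w))) * (√w)⁻¹) = 1 := by
    have : c / (c + c * (b / w)) = w / (b + w) := by field_simp; ring
    rw [this, Real.sqrt_div hw0]
    field_simp
  rw [hR]
  simp only [reconstruct, auxStat, dir, ← hb_def, ← hw_def, ← hc_def, smul_add, smul_smul, e1, e2,
    one_smul, Matrix.sub_mul, Matrix.one_mul]
  abel

end Reconstruction

/-! ### The probability of a sequence of merges -/

section Selection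

variable {n p : ℕ} {d : Merge n → Matrix (Fin n) (Fin p) ℝ → ℝ} {τ : ℝ}

theorem selProb_nonneg (𝓒 : Finset (Finset (Fin n))) (M : Merge n) (x : Matrix (Fin n) (Fin p) ℝ) :
    0 ≤ selProb d τ 𝓒 M x := by
  unfold selProb
  split_ifs
  · positivity
  · exact le_rfl

theorem selProb_pos {𝓒 : Finset (Finset (Fin n))} {M : Merge n} (hM : M ∈ candidates 𝓒)
    (x : Matrix (Fin n) (Fin p) ℝ) : 0 < selProb d τ 𝓒 M x := by
  rw [selProb, if_pos hM]
  exact div_pos (Real.exp_pos _) (Finset.sum_pos (fun _ _ => Real.exp_pos _) ⟨M, hM⟩)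

theorem selProb_le_one (𝓒 : Finset (Finset (Fin n))) (M : Merge n)
    (x : Matrix (Fin n) (Fin p) ℝ) : selProb d τ 𝓒 M x ≤ 1 := by
  unfold selProb
  split_ifs with h
  · refine div_le_one_of_le₀ ?_ (by positivity)
    exact Finset.single_le_sum (f := fun M' => Real.exp (-(d M' x / temperature d τ 𝓒 x)))
      (fun _ _ => (Real.exp_pos _).le) h
  · exact zero_le_one

theorem measurable_selProb (hd : ∀ M, Measurable (d M)) (𝓒 : Finset (Finset (Fin n)))
    (M : Merge n) : Measurable (selProb d τ 𝓒 M) := by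
  have hT : Measurable (temperature d τ 𝓒) := by
    unfold temperature
    exact ((Finset.measurable_sum _ fun M _ => hd M).div_const _).const_mul _
  have hE : ∀ M', Measurable fun x => Real.exp (-(d M' x / temperature d τ 𝓒 x)) := fun M' =>
    (((hd M').div hT).neg).exp
  unfold selProb
  split_ifs
  · exact (hE M).div (Finset.measurable_sum _ fun M' _ => hE M')
  · exact measurable_const

/-- The probability that the merges numbered `0, …, s - 1` are `m 0, …, m (s - 1)`, given the
data `x`. -/
def mergesProb (d : Merge n → Matrix (Fin n) (Fin p) ℝ → ℝ) (τ : ℝ) (m : ℕ → Merge n) (s : ℕ)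
    (x : Matrix (Fin n) (Fin p) ℝ) : ℝ :=
  ∏ j ∈ Finset.range s, selProb d τ (clusters m j) (m j) x

theorem mergesProb_nonneg (m : ℕ → Merge n) (s : ℕ) (x : Matrix (Fin n) (Fin p) ℝ) :
    0 ≤ mergesProb d τ m s x :=
  Finset.prod_nonneg fun _ _ => selProb_nonneg _ _ _

theorem mergesProb_le_one (m : ℕ → Merge n) (s : ℕ) (x : Matrix (Fin n) (Fin p) ℝ) :
    mergesProb d τ m s x ≤ 1 :=
  Finset.prod_le_one (fun _ _ => selProb_nonneg _ _ _) fun _ _ => selProb_le_one _ _ _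

theorem mergesProb_pos {m : ℕ → Merge n} {s : ℕ} (hm : ∀ j < s, m j ∈ candidates (clusters m j))
    (x : Matrix (Fin n) (Fin p) ℝ) : 0 < mergesProb d τ m s x :=
  Finset.prod_pos fun j hj => selProb_pos (hm j (Finset.mem_range.1 hj)) x

theorem measurable_mergesProb (hd : ∀ M, Measurable (d M)) (m : ℕ → Merge n) (s : ℕ) :
    Measurable (mergesProb d τ m s) :=
  Finset.measurable_prod _ fun _ _ => measurable_selProb hd _ _

theorem clusters_congr {m m' : ℕ → Merge n} {s : ℕ} (h : ∀ j < s, m j = m' j) :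
    clusters m s = clusters m' s := by
  induction s with
  | zero => rfl
  | succ s ih => rw [clusters, clusters, ih fun j hj => h j (by omega), h s (by omega)]

variable {Ω : Type*} {μ : Matrix (Fin n) (Fin p) ℝ} {σ : ℝ≥0} {t : ℕ}
  {X : Ω → Matrix (Fin n) (Fin p) ℝ} {M : ℕ → Ω → Merge n}

theorem measurableSet_past_merges (X : Ω → Matrix (Fin n) (Fin p) ℝ) (M : ℕ → Ω → Merge n)
    (m : ℕ → Merge n) (s : ℕ) : MeasurableSet[past X M s] {ω | ∀ j < s, M j ω = m j} := by
  have e : {ω | ∀ j < s, M j ω = m j} = ⋂ j ∈ Finset.range s, M j ⁻¹' {m j} := by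
    ext ω; simp
  rw [e]
  refine Finset.measurableSet_biInter _ fun j hj => ?_
  have hle : MeasurableSpace.comap (M j) ⊤ ≤ past X M s :=
    le_sup_of_le_right (le_iSup₂_of_le j hj le_rfl)
  exact hle _ ⟨{m j}, trivial, rfl⟩

variable [mΩ : MeasurableSpace Ω] {P : Measure Ω}

theorem past_le (h : IsRandomizedClustering P μ σ d τ t X M) {s : ℕ} (hs : s ≤ t + 1) :
    past X M s ≤ mΩ := by
  refine sup_le h.measurable_data.comap_le (iSup₂_le fun j hj => ?_)
  have := Finset.mem_range.1 hj
  exact (h.measurable_merge j (by omega)).comap_le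

/-- On the event that the first merges are the prescribed ones, the law of the data has density
`mergesProb`. In the inductive step the conditional probability of the next merge is integrated over
an event of the past, on which the current clusters are those left by the prescribed merges. -/
theorem map_restrict_merges [IsProbabilityMeasure P] (h : IsRandomizedClustering P μ σ d τ t X M)
    (hd : ∀ M, Measurable (d M)) (m : ℕ → Merge n) {s : ℕ} (hs : s ≤ t + 1) :
    (P.restrict {ω | ∀ j < s, M j ω = m j}).map X =
      (matrixNormal μ σ).withDensity fun x => ENNReal.ofReal (mergesProb d τ m s x) := by
  induction s with
  | zero => simp [mergesProb, h.law_data]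
  | succ s ih =>
    have ih := ih (by omega)
    have hX := h.measurable_data
    have hle := past_le h (s := s) (by omega)
    have hE := measurableSet_past_merges X M m s
    have hMs : MeasurableSet (M s ⁻¹' {m s}) := h.measurable_merge s (by omega) trivial
    have hset : {ω | ∀ j < s + 1, M j ω = m j} =
        {ω | ∀ j < s, M j ω = m j} ∩ M s ⁻¹' {m s} := by
      ext ω
      simp only [mem_ofPred_eq, mem_inter_iff, mem_preimage, mem_singleton_iff]
      exact Nat.forall_lt_succ_right
    have hp := measurable_selProb (τ := τ) hd (clusters m s) (m s)
    ext B hB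
    have hA : MeasurableSet[past X M s] (X ⁻¹' B ∩ {ω | ∀ j < s, M j ω = m j}) :=
      MeasurableSet.inter ((le_sup_left : _ ≤ past X M s) _ ⟨B, hB, rfl⟩) hE
    have key : P (X ⁻¹' B ∩ {ω | ∀ j < s, M j ω = m j} ∩ M s ⁻¹' {m s}) =
        ∫⁻ ω in X ⁻¹' B ∩ {ω | ∀ j < s, M j ω = m j},
          ENNReal.ofReal (selProb d τ (clusters m s) (m s) (X ω)) ∂P := by
      have h1 := setIntegral_condExp (μ := P) hle
        (f := (M s ⁻¹' {m s}).indicator fun _ => (1 : ℝ))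
        ((integrable_const _).indicator hMs) hA
      rw [setIntegral_congr_ae (g := fun ω => selProb d τ (clusters m s) (m s) (X ω)) (hle _ hA),
        setIntegral_indicator hMs, setIntegral_const, smul_eq_mul, mul_one] at h1
      · rw [← ofReal_integral_eq_lintegral_ofReal, h1, ofReal_measureReal]
        · refine Integrable.of_bound (C := 1) (hp.comp hX).aestronglyMeasurable
            (Filter.Eventually.of_forall fun ω => ?_)
          rw [Real.norm_of_nonneg (selProb_nonneg _ _ _)]
          exact selProb_le_one _ _ _
        · exact Filter.Eventually.of_forall fun ω => selProb_nonneg _ _ _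
      · filter_upwards [h.cond_prob_merge s (by omega) (m s)] with ω hω hωA
        rw [hω, clusters_congr hωA.2]
    rw [Measure.map_apply hX hB, Measure.restrict_apply (hX hB), hset, ← inter_assoc, key,
      withDensity_apply _ hB]
    have e : ∀ x, ENNReal.ofReal (mergesProb d τ m (s + 1) x) =
        ENNReal.ofReal (mergesProb d τ m s x) *
          ENNReal.ofReal (selProb d τ (clusters m s) (m s) x) := by
      intro x
      rw [← ENNReal.ofReal_mul (mergesProb_nonneg _ _ _), mergesProb, Finset.prod_range_succ]
      rfl
    simp_rw [e]
    have h2 := setLIntegral_withDensity_eq_setLIntegral_mul (matrixNormal μ σ)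
      (measurable_mergesProb (τ := τ) hd m s).ennreal_ofReal hp.ennreal_ofReal hB
    simp only [Pi.mul_apply] at h2
    rw [← h2, ← ih, setLIntegral_map hB hp.ennreal_ofReal hX, Measure.restrict_restrict (hX hB)]

end Selection

/-! ### The conditional law of the test statistic -/

theorem map_withDensity_comp {α β : Type*} [MeasurableSpace α] [MeasurableSpace β] (ν : Measure α)
    {f : α → β} (hf : Measurable f) {w : β → ℝ≥0∞} (hw : Measurable w) :
    (ν.withDensity (w ∘ f)).map f = (ν.map f).withDensity w := by
  ext s hs
  rw [Measure.map_apply hf hs, withDensity_apply _ (hf hs), withDensity_apply _ hs,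
    setLIntegral_map hs hw hf]
  rfl

/-- If the joint law of `(A, R)` has density `c * w` with respect to a product measure `ν.prod ρ`,
then the conditional law of `R` given `A = a` has density proportional to `w (a, ·)` with respect
to `ρ`. -/
theorem condDistrib_ae_eq_of_map_eq_withDensity {Ω α : Type*} [MeasurableSpace Ω]
    [MeasurableSpace α] {P : Measure Ω} [IsFiniteMeasure P] {A : Ω → α} {R : Ω → ℝ}
    (hA : Measurable A) (hR : Measurable R) {ν : Measure α} [SFinite ν] {ρ : Measure ℝ} [SFinite ρ]
    {w : α × ℝ → ℝ≥0∞} (hw : Measurable w) {c : ℝ≥0∞}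
    (hmap : P.map (fun ω => (A ω, R ω)) = c • (ν.prod ρ).withDensity w)
    (hw0 : ∀ a, ∫⁻ r, w (a, r) ∂ρ ≠ 0) (hwt : ∀ a, ∫⁻ r, w (a, r) ∂ρ ≠ ∞) :
    ∀ᵐ a ∂(P.map A), condDistrib R A P a =
      (∫⁻ r, w (a, r) ∂ρ)⁻¹ • ρ.withDensity fun r => w (a, r) := by
  set D : α → ℝ≥0∞ := fun a => ∫⁻ r, w (a, r) ∂ρ
  have hD : Measurable D := hw.lintegral_prod_right'
  have hg : Measurable (Function.uncurry fun a r => (D a)⁻¹ * w (a, r)) := by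
    unfold Function.uncurry; fun_prop
  let κ : Kernel α ℝ := (Kernel.const α ρ).withDensity fun a r => (D a)⁻¹ * w (a, r)
  have hκ : ∀ a, κ a = (D a)⁻¹ • ρ.withDensity fun r => w (a, r) := by
    intro a
    rw [Kernel.withDensity_apply _ hg, Kernel.const_apply]
    exact withDensity_smul (D a)⁻¹ (f := fun r => w (a, r)) (by fun_prop)
  have : IsMarkovKernel κ := ⟨fun a => ⟨by
    rw [hκ, Measure.smul_apply, withDensity_apply _ .univ, Measure.restrict_univ, smul_eq_mul]
    exact ENNReal.inv_mul_cancel (hw0 a) (hwt a)⟩⟩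
  have hjoint : P.map (fun ω => (A ω, R ω)) = P.map A ⊗ₘ κ := by
    refine Measure.ext_of_lintegral _ fun f hf => ?_
    have hfst : ∀ g : α → ℝ≥0∞, Measurable g →
        ∫⁻ a, g a ∂(P.map A) = c * ∫⁻ a, D a * g a ∂ν := by
      intro g hg
      have e : P.map A = (P.map (fun ω => (A ω, R ω))).map Prod.fst := by
        rw [Measure.map_map measurable_fst (hA.prodMk hR)]; rfl
      rw [e, hmap, lintegral_map hg measurable_fst, lintegral_smul_measure, smul_eq_mul,
        lintegral_withDensity_eq_lintegral_mul _ hw (g := fun q => g q.1) (by fun_prop),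
        lintegral_prod _ (by fun_prop)]
      congr 1
      refine lintegral_congr fun a => ?_
      simp only [Pi.mul_apply]
      rw [lintegral_mul_const _ (by fun_prop)]
    rw [Measure.lintegral_compProd hf, hfst _ hf.lintegral_kernel_prod_right', hmap,
      lintegral_smul_measure, smul_eq_mul, lintegral_withDensity_eq_lintegral_mul _ hw hf,
      lintegral_prod _ (by fun_prop)]
    congr 1
    refine lintegral_congr fun a => ?_
    rw [hκ, lintegral_smul_measure, smul_eq_mul, ← mul_assoc,
      ENNReal.mul_inv_cancel (hw0 a) (hwt a), one_mul,
      lintegral_withDensity_eq_lintegral_mul _ (by fun_prop) (by fun_prop)]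
    rfl
  filter_upwards [condDistrib_ae_eq_of_measure_eq_compProd A hR.aemeasurable hjoint] with a ha
  rw [ha, hκ]

section SelectionWeight

variable {n p : ℕ} {d : Merge n → Matrix (Fin n) (Fin p) ℝ → ℝ} {τ : ℝ} {C₁ C₂ : Finset (Fin n)}

theorem measurable_reconstruct (C₁ C₂ : Finset (Fin n)) :
    Measurable fun q : Aux n p × ℝ => reconstruct C₁ C₂ q.2 q.1 := by
  have hentry : ∀ (i : Fin n) (j : Fin p),
      Measurable fun x : Matrix (Fin n) (Fin p) ℝ => x i j := fun i j =>
    (measurable_pi_apply j).comp (measurable_pi_apply (X := fun _ : Fin n => Fin p → ℝ) i)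
  refine measurable_pi_lambda _ fun i => measurable_pi_lambda _ fun j => ?_
  have h1 : Measurable fun q : Aux n p × ℝ => q.1.1 i j :=
    (hentry i j).comp (measurable_fst.comp measurable_fst)
  have h2 : Measurable fun q : Aux n p × ℝ => q.1.2.1 i j :=
    (hentry i j).comp (measurable_fst.comp (measurable_snd.comp measurable_fst))
  have h3 : Measurable fun q : Aux n p × ℝ => q.1.2.2.2 i j :=
    (hentry i j).comp
      (measurable_snd.comp (measurable_snd.comp (measurable_snd.comp measurable_fst)))
  change Measurable fun q : Aux n p × ℝ => √q.1.2.2.1 *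
    (√(q.2 / (pairSize C₁ C₂ - 2 + q.2)) * q.1.1 i j +
      √((pairSize C₁ C₂ - 2) / (pairSize C₁ C₂ - 2 + q.2)) * q.1.2.1 i j) + q.1.2.2.2 i j
  fun_prop

theorem selWeight_eq (t : ℕ) (m : ℕ → Merge n) (a : Aux n p) (r : ℝ) :
    selWeight d τ t m C₁ C₂ a r = fDensity p ((pairSize C₁ C₂ - 2) * p) r *
      mergesProb d τ m (t + 1) (reconstruct C₁ C₂ r a) := rfl

theorem measurable_selWeight (hd : ∀ M, Measurable (d M)) (t : ℕ) (m : ℕ → Merge n)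
    (a : Aux n p) : Measurable (selWeight d τ t m C₁ C₂ a) :=
  (measurable_fDensity _ _).mul ((measurable_mergesProb hd m (t + 1)).comp
    ((measurable_reconstruct C₁ C₂).comp measurable_prodMk_left))

theorem selWeight_pos (hp : 0 < p) (hN : 3 ≤ C₁.card + C₂.card) {t : ℕ} {m : ℕ → Merge n}
    (hm : ∀ s ≤ t, m s ∈ candidates (clusters m s)) (a : Aux n p) {r : ℝ} (hr : 0 < r) :
    0 < selWeight d τ t m C₁ C₂ a r := by
  have hc : 0 < pairSize C₁ C₂ - 2 := by
    have : (3 : ℝ) ≤ pairSize C₁ C₂ := by unfold pairSize; exact_mod_cast hN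
    linarith
  have hp' : (0 : ℝ) < p := Nat.cast_pos.2 hp
  exact mul_pos (fDensity_pos hp' (by positivity) hr)
    (mergesProb_pos (fun j hj => hm j (by omega)) _)

theorem integrableOn_selWeight (hd : ∀ M, Measurable (d M)) (hp : 0 < p)
    (hN : 3 ≤ C₁.card + C₂.card) {t : ℕ} {m : ℕ → Merge n}
    (hm : ∀ s ≤ t, m s ∈ candidates (clusters m s))
    (hF : IsFiniteMeasure (fMeasure p ((pairSize C₁ C₂ - 2) * p))) (a : Aux n p) :
    IntegrableOn (selWeight d τ t m C₁ C₂ a) (Ioi 0) := by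
  refine ⟨(measurable_selWeight hd t m a).aestronglyMeasurable, ?_⟩
  have hfin : fMeasure p ((pairSize C₁ C₂ - 2) * p) univ < ∞ := measure_lt_top _ _
  rw [fMeasure, withDensity_apply _ .univ, Measure.restrict_univ] at hfin
  refine lt_of_le_of_lt (setLIntegral_mono (by fun_prop) fun r hr => ?_) hfin
  have hpos := selWeight_pos (d := d) (τ := τ) hp hN hm a hr
  rw [Real.enorm_of_nonneg hpos.le]
  refine ENNReal.ofReal_le_ofReal ?_
  rw [selWeight_eq] at hpos ⊢
  have hf : 0 ≤ fDensity p ((pairSize C₁ C₂ - 2) * p) r :=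
    (pos_of_mul_pos_left hpos (mergesProb_nonneg _ _ _)).le
  exact mul_le_of_le_one_right hf (mergesProb_le_one _ _ _)

theorem integral_selWeight_pos (hp : 0 < p) (hN : 3 ≤ C₁.card + C₂.card) {t : ℕ}
    {m : ℕ → Merge n} (hm : ∀ s ≤ t, m s ∈ candidates (clusters m s)) {a : Aux n p}
    (hint : IntegrableOn (selWeight d τ t m C₁ C₂ a) (Ioi 0)) :
    0 < ∫ r in Ioi 0, selWeight d τ t m C₁ C₂ a r := by
  have hpos : ∀ r ∈ Ioi (0 : ℝ), 0 < selWeight d τ t m C₁ C₂ a r := fun r hr =>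
    selWeight_pos hp hN hm a hr
  rw [setIntegral_pos_iff_support_of_nonneg_ae
    ((ae_restrict_mem measurableSet_Ioi).mono fun r hr => (hpos r hr).le) hint,
    inter_eq_right.2 (show Ioi (0 : ℝ) ⊆ Function.support _ from fun r hr => (hpos r hr).ne')]
  simp

end SelectionWeight

end RandClust

end

open RandClust Set in
open scoped ENNReal in
theorem theorem1 {Ω : Type*} [MeasurableSpace Ω] (P : Measure Ω) [IsProbabilityMeasure P]
    {n p : ℕ} (hp : 0 < p)
    -- the model
    (μ : Matrix (Fin n) (Fin p) ℝ) (σ : ℝ≥0) (hσ : 0 < σ)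
    -- the dissimilarity between clusters and the randomization parameter
    (d : RandClust.Merge n → Matrix (Fin n) (Fin p) ℝ → ℝ) (hd : ∀ M, Measurable (d M))
    (hd_nonneg : ∀ M x, 0 ≤ d M x) (τ : ℝ) (hτ : 0 < τ)
    -- the data and the random merges, numbered 0, …, t
    (t : ℕ) (X : Ω → Matrix (Fin n) (Fin p) ℝ) (M : ℕ → Ω → RandClust.Merge n)
    (hXM : RandClust.IsRandomizedClustering P μ σ d τ t X M)
    -- the observed merges, the last of them being {C₁, C₂}
    (m : ℕ → RandClust.Merge n)
    (hm : ∀ s ≤ t, m s ∈ RandClust.candidates (RandClust.clusters m s))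
    (C₁ C₂ : Finset (Fin n)) (hC : m t = s(C₁, C₂)) (hN : 3 ≤ C₁.card + C₂.card)
    -- the null hypothesis
    (hnull : ∀ i ∈ C₁ ∪ C₂, ∀ i' ∈ C₁ ∪ C₂, μ i = μ i') :
    P (RandClust.mergesEq M m t) ≠ 0 ∧
    (∀ a : RandClust.Aux n p,
      IntegrableOn (RandClust.selWeight d τ t m C₁ C₂ a) (Set.Ioi 0) ∧
      0 < ∫ r in Set.Ioi 0, RandClust.selWeight d τ t m C₁ C₂ a r) ∧
    ∀ᵐ a ∂(P[|RandClust.mergesEq M m t]).map (fun ω => RandClust.auxStat C₁ C₂ (X ω)),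
      ∀ r : ℝ,
        cdf (condDistrib (fun ω => RandClust.testStat C₁ C₂ (X ω))
            (fun ω => RandClust.auxStat C₁ C₂ (X ω)) P[|RandClust.mergesEq M m t] a) r =
          (∫ r' in Set.Ioc 0 r, RandClust.selWeight d τ t m C₁ C₂ a r') /
            ∫ r' in Set.Ioi 0, RandClust.selWeight d τ t m C₁ C₂ a r' := by
  have hX := hXM.measurable_data
  obtain ⟨hne, hdisj⟩ := clusters_nonempty_disjoint m t fun j hj => hm j hj.le
  have hmt := hm t le_rfl
  rw [hC] at hmt
  simp only [candidates, Finset.mem_filter, Finset.mk_mem_sym2_iff, Sym2.mk_isDiag_iff] at hmt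
  obtain ⟨⟨hC₁, hC₂⟩, hC₁₂⟩ := hmt
  have h₁ := hne C₁ hC₁
  have h₂ := hne C₂ hC₂
  have h := hdisj C₁ hC₁ C₂ hC₂ hC₁₂
  have hE : mergesEq M m t = {ω | ∀ j < t + 1, M j ω = m j} := by
    simp only [mergesEq, Nat.lt_add_one_iff]
  have hmap := map_restrict_merges hXM hd m (le_refl (t + 1))
  rw [← hE] at hmap
  set E := mergesEq M m t with hE_def
  have hprob : ∀ x, 0 < mergesProb d τ m (t + 1) x :=
    fun x => mergesProb_pos (fun j hj => hm j (by omega)) x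
  have hprobm := measurable_mergesProb (τ := τ) hd m (t + 1)
  have hPE : P E ≠ 0 := by
    intro h0
    rw [Measure.restrict_eq_zero.2 h0, Measure.map_zero, eq_comm,
      withDensity_eq_zero_iff hprobm.ennreal_ofReal.aemeasurable] at hmap
    obtain ⟨x, hx⟩ := hmap.exists
    exact (hprob x).not_ge (ENNReal.ofReal_eq_zero.1 hx)
  obtain ⟨K, hK0, hKt, hKprob, hjoint⟩ :=
    exists_map_auxStat_testStat hp h₁ h₂ h hN hnull hσ
  have hF : IsFiniteMeasure (fMeasure p ((pairSize C₁ C₂ - 2) * p)) := by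
    refine ⟨lt_top_iff_ne_top.2 fun htop => ?_⟩
    have := hKprob.measure_univ
    rw [Measure.smul_apply, htop, smul_eq_mul, ENNReal.mul_top hK0] at this
    exact ENNReal.top_ne_one this
  have hint := fun a => integrableOn_selWeight (d := d) (τ := τ) hd hp hN hm hF a
  have hIpos := fun a => integral_selWeight_pos hp hN hm (hint a)
  refine ⟨hPE, fun a => ⟨hint a, hIpos a⟩, ?_⟩
  have hA := measurable_auxStat (p := p) (C₁ := C₁) (C₂ := C₂)
  have hR := measurable_testStat (p := p) h₁ h₂ h
  set ρ := K • fMeasure p ((pairSize C₁ C₂ - 2) * p) with hρ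
  let w : Aux n p × ℝ → ℝ≥0∞ := fun q =>
    ENNReal.ofReal (mergesProb d τ m (t + 1) (reconstruct C₁ C₂ q.2 q.1))
  have hw : Measurable w := (hprobm.comp (measurable_reconstruct C₁ C₂)).ennreal_ofReal
  have hρ0 : ρ (Iic 0) = 0 := by
    rw [hρ, Measure.smul_apply, fMeasure, withDensity_apply _ measurableSet_Iic,
      Measure.restrict_restrict measurableSet_Iic, Iic_inter_Ioi, Ioc_self]
    simp
  -- the data are recovered from the statistics
  have hrec : (fun x => ENNReal.ofReal (mergesProb d τ m (t + 1) x)) =ᵐ[matrixNormal μ σ]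
      w ∘ fun x => (auxStat C₁ C₂ x, testStat C₁ C₂ x) := by
    have hpos : ∀ᵐ x ∂(matrixNormal μ σ), 0 < testStat C₁ C₂ x := by
      rw [ae_iff]
      have e : {x | ¬ 0 < testStat (p := p) C₁ C₂ x} =
          (fun x => (auxStat C₁ C₂ x, testStat C₁ C₂ x)) ⁻¹' (univ ×ˢ Iic 0) := by
        ext x; simp
      rw [e, ← Measure.map_apply (hA.prodMk hR) (MeasurableSet.univ.prod measurableSet_Iic),
        hjoint, Measure.prod_prod, hρ0, mul_zero]
    filter_upwards [hpos] with x hx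
    simp only [w, Function.comp_apply, reconstruct_auxStat h₁ h₂ h hN hx]
  have hlaw : (P[|E]).map (fun ω => (auxStat C₁ C₂ (X ω), testStat C₁ C₂ (X ω))) =
      (P E)⁻¹ • (((matrixNormal μ σ).map (auxStat C₁ C₂)).prod ρ).withDensity w := by
    rw [← hjoint, ← map_withDensity_comp _ (hA.prodMk hR) hw, ← withDensity_congr_ae hrec, ← hmap,
      Measure.map_map (hA.prodMk hR) hX, ProbabilityTheory.cond, Measure.map_smul]
    rfl
  -- a factor `K` appears in the numerator and in the denominator of the ratio, and cancels
  have hDint : ∀ (a : Aux n p) (S : Set ℝ), MeasurableSet S → ∫⁻ r in S, w (a, r) ∂ρ =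
      K * ENNReal.ofReal (∫ r in S ∩ Ioi 0, selWeight d τ t m C₁ C₂ a r) := by
    intro a S hS
    have hwa : Measurable fun r => w (a, r) := hw.comp measurable_prodMk_left
    rw [hρ, Measure.restrict_smul, lintegral_smul_measure, smul_eq_mul, fMeasure,
      setLIntegral_withDensity_eq_setLIntegral_mul _ (by fun_prop) hwa hS,
      Measure.restrict_restrict hS, ofReal_integral_eq_lintegral_ofReal]
    · congr 1
      refine setLIntegral_congr_fun (hS.inter measurableSet_Ioi) fun r hr => ?_
      simp only [Pi.mul_apply, w]
      rw [selWeight_eq, ENNReal.ofReal_mul' (mergesProb_nonneg _ _ _)]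
    · exact (hint a).mono_set inter_subset_right
    · filter_upwards [ae_restrict_mem (hS.inter measurableSet_Ioi)] with r hr
      exact (selWeight_pos hp hN hm a hr.2).le
  have hDuniv : ∀ a : Aux n p, ∫⁻ r, w (a, r) ∂ρ =
      K * ENNReal.ofReal (∫ r in Ioi 0, selWeight d τ t m C₁ C₂ a r) := by
    intro a
    have := hDint a univ .univ
    rwa [Measure.restrict_univ, univ_inter] at this
  have hcond : IsProbabilityMeasure P[|E] := cond_isProbabilityMeasure hPE
  have hae := condDistrib_ae_eq_of_map_eq_withDensity (hA.comp hX) (hR.comp hX) hw hlaw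
    (fun a => by
      rw [hDuniv]
      exact mul_ne_zero hK0 (by simpa using hIpos a))
    (fun a => by
      rw [hDuniv]
      exact ENNReal.mul_ne_top hKt ENNReal.ofReal_ne_top)
  filter_upwards [hae] with a ha r
  have ha' : condDistrib (fun ω => testStat C₁ C₂ (X ω)) (fun ω => auxStat C₁ C₂ (X ω)) P[|E] a =
    (∫⁻ r, w (a, r) ∂ρ)⁻¹ • ρ.withDensity fun r => w (a, r) := ha
  rw [cdf_eq_real, ha', measureReal_def, Measure.smul_apply,
    withDensity_apply _ measurableSet_Iic, hDint a _ measurableSet_Iic, hDuniv, Iic_inter_Ioi,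
    smul_eq_mul, ← ENNReal.div_eq_inv_mul, ENNReal.mul_div_mul_left _ _ hK0 hKt,
    ENNReal.toReal_div, ENNReal.toReal_ofReal (hIpos a).le, ENNReal.toReal_ofReal]
  exact setIntegral_nonneg measurableSet_Ioc fun r hr => (selWeight_pos hp hN hm a hr.1).le
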